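/- For an integer $n\ge 1$ let $p(n)$ be the $n$-th prime number ($p(1)=2$), and let $S(n)$ be the additive submonoid of $\mathbb{N}=\{0,1,2,\dots\}$ generated by all prime numbers $q\ge p(n)$. A gap of $S(n)$ is a positive integer not in $S(n)$; let $g(n)$ be the number of gaps, $f(n)$ the largest gap, and $s(n)=f(n)+1-g(n)$ (the number of elements of $S(n)$ that are less than $f(n)$). An atom of $S(n)$ is a nonzero element of $S(n)$ that is not the sum of two positive elements of $S(n)$; let $e(n)$ be the number of atoms and $u(n)$ the greatest atom. Then, all minima being taken over the integers $n\ge 1$: (a) $\min_n \frac{f(n)}{p(n)}=\min_n\frac{g(n)}{p(n)}=\frac12$. (b) $\min_n\frac{u(n)}{p(n)}=\frac32$, and this value is attained only at $n=1$; moreover $\frac{u(n)}{p(n)}>2$ for all $n>1$. (c) $\min_n\frac{e(n)}{n}=\frac54$, and this value is attained at $n=8$; moreover $e(n)>n$ and $s(n)>n-1$ for all $n\ge 1$. -/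

import Mathlib

namespace PrimeSemigroup

/-- `p n` is the `n`-th prime number, counted from `p 1 = 2`.
The value at `n = 0` is irrelevant. -/
noncomputable def p (n : ℕ) : ℕ := Nat.nth Nat.Prime (n - 1)

/-- The numerical semigroup `S n`: the additive submonoid of `ℕ` generated by all the prime
numbers not less than `p n`. -/
noncomputable def S (n : ℕ) : AddSubmonoid ℕ :=
  AddSubmonoid.closure {q : ℕ | q.Prime ∧ p n ≤ q}

/-- The gaps of `S n`: the positive integers that do not belong to `S n`. -/
def gaps (n : ℕ) : Set ℕ := {x : ℕ | 0 < x ∧ x ∉ S n}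

/-- The genus of `S n`: the number of gaps. -/
noncomputable def g (n : ℕ) : ℕ := (gaps n).ncard

/-- The Frobenius number of `S n`: the largest gap. -/
noncomputable def f (n : ℕ) : ℕ := sSup (gaps n)

/-- `s n = f n + 1 - g n` (as an integer), which is the number of elements of `S n` that are less
than `f n`. -/
noncomputable def s (n : ℕ) : ℤ := (f n : ℤ) + 1 - (g n : ℤ)

/-- The atoms of `S n`: the nonzero elements of `S n` that are not the sum of two positive
elements of `S n`. -/
def atoms (n : ℕ) : Set ℕ :=
  {a : ℕ | a ∈ S n ∧ 0 < a ∧ ¬ ∃ x ∈ S n, ∃ y ∈ S n, 0 < x ∧ 0 < y ∧ a = x + y}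

/-- The embedding dimension of `S n`: the number of atoms. -/
noncomputable def e (n : ℕ) : ℕ := (atoms n).ncard

/-- The greatest atom of `S n`. -/
noncomputable def u (n : ℕ) : ℕ := sSup (atoms n)

/-! The following facts show that the suprema and cardinalities above are genuine. -/

theorem prime_p (n : ℕ) : (p n).Prime := Nat.prime_nth_prime _

/-- `p n` is the prime with `π (p n) = n`. -/
theorem primeCounting_p {n : ℕ} (hn : 0 < n) : Nat.primeCounting (p n) = n := by
  have h := Nat.primeCounting'_nth_eq (n - 1)
  have hp : Nat.Prime (Nat.nth Nat.Prime (n - 1)) := Nat.prime_nth_prime _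
  rw [Nat.primeCounting_eq_primeCounting'_succ, p, Nat.primeCounting', Nat.count_succ, if_pos hp]
  rw [Nat.primeCounting'] at h
  omega

theorem p_mem_S (n : ℕ) : p n ∈ S n :=
  AddSubmonoid.subset_closure ⟨prime_p n, le_rfl⟩

theorem exists_forall_ge_mem_S (n : ℕ) : ∃ N, ∀ m ≥ N, m ∈ S n := by
  obtain ⟨N, hN⟩ := Nat.exists_mem_closure_of_ge {q : ℕ | q.Prime ∧ p n ≤ q}
  refine ⟨N, fun m hm => hN m hm ?_⟩
  obtain ⟨q, hq, hqp⟩ := Nat.exists_infinite_primes (p n + 1)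
  have h1 : Nat.setGcd {q : ℕ | q.Prime ∧ p n ≤ q} ∣ p n :=
    Nat.setGcd_dvd_of_mem ⟨prime_p n, le_rfl⟩
  have h2 : Nat.setGcd {q : ℕ | q.Prime ∧ p n ≤ q} ∣ q :=
    Nat.setGcd_dvd_of_mem ⟨hqp, by omega⟩
  have h3 : Nat.Coprime (p n) q := (Nat.coprime_primes (prime_p n) hqp).2 (by omega)
  have h4 := Nat.dvd_gcd h1 h2
  rw [h3] at h4
  exact h4.trans (one_dvd m)

theorem eq_zero_or_p_le {n x : ℕ} (hx : x ∈ S n) : x = 0 ∨ p n ≤ x := by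
  refine AddSubmonoid.closure_induction (motive := fun x _ => x = 0 ∨ p n ≤ x)
    (fun y hy => Or.inr hy.2) (Or.inl rfl) (fun a b _ _ ha hb => ?_) hx
  omega

theorem finite_gaps (n : ℕ) : (gaps n).Finite := by
  obtain ⟨N, hN⟩ := exists_forall_ge_mem_S n
  refine (Set.finite_Iio N).subset fun x hx => ?_
  by_contra h
  exact hx.2 (hN x (not_lt.1 h))

theorem one_mem_gaps (n : ℕ) : 1 ∈ gaps n := by
  refine ⟨one_pos, fun h => ?_⟩
  have := (prime_p n).two_le
  have := eq_zero_or_p_le h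
  omega

theorem isGreatest_f (n : ℕ) : IsGreatest (gaps n) (f n) :=
  ⟨Nat.sSup_mem ⟨1, one_mem_gaps n⟩ (finite_gaps n).bddAbove,
    fun _ hx => le_csSup (finite_gaps n).bddAbove hx⟩

/-- `s n` counts the sporadic elements of `S n`. -/
theorem s_eq_ncard (n : ℕ) : s n = ({x : ℕ | x ∈ S n ∧ x < f n}.ncard : ℤ) := by
  have hf := isGreatest_f n
  have hu : {x : ℕ | x ∈ S n ∧ x < f n} ∪ gaps n = Set.Iic (f n) := by
    ext x
    simp only [Set.mem_union, Set.mem_ofPred_eq, Set.mem_Iic]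
    constructor
    · rintro (h | h)
      · exact h.2.le
      · exact hf.2 h
    · intro h
      by_cases hx : x ∈ S n
      · refine Or.inl ⟨hx, lt_of_le_of_ne h ?_⟩
        rintro rfl
        exact hf.1.2 hx
      · refine Or.inr ⟨Nat.pos_of_ne_zero ?_, hx⟩
        rintro rfl
        exact hx (zero_mem _)
  have hd : Disjoint {x : ℕ | x ∈ S n ∧ x < f n} (gaps n) :=
    Set.disjoint_left.2 fun x hx hg => hg.2 hx.1
  have hc := Set.ncard_union_eq hd ((Set.finite_Iio (f n)).subset fun x hx => hx.2)
    (finite_gaps n)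
  have hi : (Set.Iic (f n)).ncard = f n + 1 := by
    rw [← Finset.coe_Iic, Set.ncard_coe_finset, Nat.card_Iic]
  rw [hu, hi] at hc
  unfold s g
  omega

theorem finite_atoms (n : ℕ) : (atoms n).Finite := by
  obtain ⟨N, hN⟩ := exists_forall_ge_mem_S n
  refine (Set.finite_Iic (N + p n)).subset fun a ha => ?_
  by_contra h
  rw [Set.mem_Iic, not_le] at h
  have hp := (prime_p n).pos
  exact ha.2.2 ⟨p n, p_mem_S n, a - p n, hN _ (by omega), hp, by omega, by omega⟩

theorem p_mem_atoms (n : ℕ) : p n ∈ atoms n := by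
  refine ⟨p_mem_S n, (prime_p n).pos, ?_⟩
  rintro ⟨x, hx, y, hy, hx0, hy0, h⟩
  have := eq_zero_or_p_le hx
  have := eq_zero_or_p_le hy
  omega

theorem isGreatest_u (n : ℕ) : IsGreatest (atoms n) (u n) :=
  ⟨Nat.sSup_mem ⟨p n, p_mem_atoms n⟩ (finite_atoms n).bddAbove,
    fun _ hx => le_csSup (finite_atoms n).bddAbove hx⟩

end PrimeSemigroup

/-! Write `p` for `p n`. The numbers below `p` are gaps, so `f` and `g` are at least `p - 1 ≥ p /
2`, with equality at `p = 2`. For `n > 1` all generators are odd, so below `3p` the semigroup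
contains only `0`, primes and even numbers (`mem_S_cases`); hence every prime in `[p, 3p)` is an
atom. Everything else rests on the supply of primes up to `3p`.

A prime between `2p` and `3p` (`exists_prime_between`) gives `u > 2p`. Counting atoms gives `e ≥
π(3p) - n + 1`, so `e ≥ 5n/4` follows from `9 π(x) ≤ 4 (π(3x) + 1)` at `x = p`, where `π(p) = n`.
This holds for `p ≥ 29`; the few exceptions below that are saved by the additional atom `3p + 2`,
and one of them, `p = 19`, gives exactly `10/8`. For `s`, the odd composite `3p - 6` is a gap when
`n > 2`, so `0` and the primes in `[p, 3p - 6)` are sporadic, and `π(3p) ≥ 2n` makes them numerous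
enough.

The inequality for `π` is proved beyond `2^17` with Chebyshev's bounds `0.9135 n ≤ θ(n) ≤ 1.109 n`,
carried over to `π` by summation by parts; below, a kernel computation with gcds checks it. The same
computation supplies the initial values of `π` and `θ` for the summation. -/

/-! ### Certified counting of primes -/

/-- The product of the odd primes up to 23. -/
def smallOddPrimes : ℕ := 111546435

/-- The product of the odd primes up to 619. -/
def oddPrimes : ℕ :=
  1349158829279772080520861039250667389097833588386983014232879018630594103020856159220724562694956467831930306184354004555600742742371131571163190349653857152038558848403915310697319118027626711179689225804493953518504143619813393286929278937601118573365471715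

/-- A primality test for odd numbers between 29 and 398160. -/
def oddPrimeTest (n : ℕ) : Bool :=
  Nat.beq (Nat.gcd (Nat.mod (bif Nat.ble n 640 then smallOddPrimes else oddPrimes) n) n) 1

/-- The number of `i < 2 ^ d` for which `m + 2 * i` passes `oddPrimeTest`. -/
def testCount (d : ℕ) : ℕ → ℕ :=
  Nat.rec (fun m => bif oddPrimeTest m then 1 else 0)
    (fun d ih m => Nat.add (ih m) (ih (Nat.add m (Nat.pow 2 (Nat.succ d))))) d

/-- `k n`, with `n` brought to normal form before it is substituted. -/
def evalThen (n : ℕ) (k : ℕ → Bool) : Bool := Nat.rec (k 0) (fun m _ => k (m + 1)) n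

/-- Starting from `a` and `b`, the numbers of primes below `c` and `3 * c`, a lower bound `l` for
the product of the former and an upper bound `u` for the product of the latter, increase `c` in `t`
steps, keeping these numbers up to date and checking on the way that `9 * π x ≤ 4 * (π (3 * x) + 1)`
for the `x` that are passed. The final values are handed to `fin`. -/
def primeWalk (fin : ℕ → ℕ → ℕ → ℕ → ℕ → Bool) (t : ℕ) : ℕ → ℕ → ℕ → ℕ → ℕ → Bool :=
  Nat.rec fin
    (fun _ ih c a b l u =>
      evalThen (Nat.log2 c - 5) fun d =>
      evalThen (2 ^ (d + 1)) fun h =>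
      evalThen (c + h) fun c' =>
      Nat.ble c' 132000 &&
      evalThen (testCount d c) fun i =>
      evalThen (testCount d (3 * c) + testCount d (3 * c + h) + testCount d (3 * c + 2 * h)) fun j =>
      evalThen (a + i) fun a' =>
      evalThen (b + j) fun b' =>
      evalThen (l * c ^ i) fun l' =>
      evalThen (u * (3 * c') ^ j) fun u' =>
      Nat.ble (9 * a') (4 * (b + 1)) && ih c' a' b' l' u') t

theorem evalThen_eq (n : ℕ) (k : ℕ → Bool) : evalThen n k = k n := by
  cases n <;> rfl

/-- An odd composite below `k * k` has an odd prime factor below `k`, which divides `P`; a prime `n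
≥ k` cannot divide `P`. -/
theorem gcd_mod_eq_one_iff_prime {P k n : ℕ} (hle : ∀ q, q.Prime → q ∣ P → q < k)
    (hdvd : ∀ q < k, q.Prime → q ≠ 2 → q ∣ P) (hodd : Odd n) (hkn : k ≤ n) (hnk : n < k * k)
    (hn : 1 < n) : Nat.gcd (P % n) n = 1 ↔ n.Prime := by
  have hg : Nat.gcd (P % n) n = Nat.gcd P n := by
    rw [Nat.gcd_comm P n, Nat.gcd_rec n P]
  rw [hg]
  constructor
  · intro h
    by_contra hp
    have hm := Nat.minFac_prime hn.ne'
    have hsq := Nat.minFac_sq_le_self (by omega) hp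
    have hlt : n.minFac < k := by nlinarith
    have h2 : n.minFac ≠ 2 := by
      intro h2
      have := Nat.minFac_dvd n
      rw [h2] at this
      rw [Nat.odd_iff] at hodd
      omega
    have := Nat.dvd_gcd (hdvd _ hlt hm h2) (Nat.minFac_dvd n)
    rw [h] at this
    exact hm.one_lt.ne' (Nat.dvd_one.1 this)
  · intro hp
    rw [← Nat.coprime_iff_gcd_eq_one, Nat.coprime_comm, hp.coprime_iff_not_dvd]
    intro h
    have := hle n hp h
    omega

theorem lt_of_prime_of_dvd_smallOddPrimes (q : ℕ) (hq : q.Prime) (h : q ∣ smallOddPrimes) :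
    q < 29 := by
  -- Dividing a factorial bounds the prime factors without factoring the number.
  have h1 : smallOddPrimes ∣ Nat.factorial 28 := by decide +kernel
  have := (hq.dvd_factorial).1 (h.trans h1)
  omega

theorem lt_of_prime_of_dvd_oddPrimes (q : ℕ) (hq : q.Prime) (h : q ∣ oddPrimes) :
    q < 631 := by
  have h1 : oddPrimes ∣ Nat.factorial 630 := by decide +kernel
  have := (hq.dvd_factorial).1 (h.trans h1)
  omega

/-- The hypothesis mentions only gcds, so the kernel decides it without primality tests; the factor
2 makes it true for even `q` as well. -/
theorem dvd_of_gcd_two_mul_ne_one {P k : ℕ} (h : ∀ q < k, q ≤ 1 ∨ Nat.gcd q (2 * P) ≠ 1)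
    (q : ℕ) (hqk : q < k) (hq : q.Prime) (h2 : q ≠ 2) : q ∣ P := by
  have h1 : q ∣ 2 * P := by
    by_contra hd
    have := (hq.coprime_iff_not_dvd).2 hd
    exact (h q hqk).elim (fun hle => absurd hq.one_lt (by omega)) fun hg => hg this
  refine (hq.dvd_mul.1 h1).resolve_left fun h3 => h2 ?_
  exact (Nat.prime_dvd_prime_iff_eq hq Nat.prime_two).1 h3

theorem dvd_smallOddPrimes : ∀ q < 29, q.Prime → q ≠ 2 → q ∣ smallOddPrimes :=
  dvd_of_gcd_two_mul_ne_one (by decide +kernel)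

theorem dvd_oddPrimes : ∀ q < 631, q.Prime → q ≠ 2 → q ∣ oddPrimes :=
  dvd_of_gcd_two_mul_ne_one (by decide +kernel)

theorem oddPrimeTest_iff {n : ℕ} (hodd : Odd n) (h1 : 29 ≤ n) (h2 : n < 398161) :
    oddPrimeTest n = true ↔ n.Prime := by
  rw [oddPrimeTest, Nat.beq_eq]
  rcases le_or_gt n 640 with h | h
  · rw [Nat.ble_eq_true_of_le h, cond_true]
    exact gcd_mod_eq_one_iff_prime lt_of_prime_of_dvd_smallOddPrimes dvd_smallOddPrimes hodd h1
      (by omega) (by omega)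
  · have : Nat.ble n 640 = false := by
      rw [← Bool.not_eq_true, Nat.ble_eq]; omega
    rw [this, cond_false]
    exact gcd_mod_eq_one_iff_prime lt_of_prime_of_dvd_oddPrimes dvd_oddPrimes hodd (by omega)
      (by omega) (by omega)

/-- The `2 ^ d` odd numbers tested fill an interval of length `2 ^ (d + 1)`; the even numbers in
between are not prime. -/
theorem count_add_testCount (d : ℕ) : ∀ m, Odd m → 29 ≤ m → m + 2 ^ (d + 1) ≤ 398161 →
    Nat.count Nat.Prime (m + 2 ^ (d + 1)) = Nat.count Nat.Prime m + testCount d m := by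
  induction d with
  | zero =>
    intro m hm h1 h2
    have he : ¬ (m + 1).Prime := fun h => by
      have := h.eq_two_or_odd
      rw [Nat.odd_iff] at hm
      omega
    have h3 : testCount 0 m = bif oddPrimeTest m then 1 else 0 := rfl
    rw [h3, show m + 2 ^ (0 + 1) = m + 1 + 1 from rfl, Nat.count_succ, Nat.count_succ, if_neg he]
    by_cases hp : m.Prime
    · rw [(oddPrimeTest_iff hm h1 (by omega)).2 hp, if_pos hp]; rfl
    · have : oddPrimeTest m = false := by
        rw [← Bool.not_eq_true, oddPrimeTest_iff hm h1 (by omega)]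
        exact hp
      rw [this, if_neg hp]; rfl
  | succ d ih =>
    intro m hm h1 h2
    have h3 : testCount (d + 1) m = testCount d m + testCount d (m + 2 ^ (d + 1)) := rfl
    have h4 : m + 2 ^ (d + 1 + 1) = m + 2 ^ (d + 1) + 2 ^ (d + 1) := by rw [pow_succ 2 (d + 1)]; ring
    rw [h4] at h2 ⊢
    have hpos : 0 < 2 ^ (d + 1) := by positivity
    have hm' : Odd (m + 2 ^ (d + 1)) := hm.add_even ⟨2 ^ d, by ring⟩
    rw [h3, ih _ hm' (by omega) h2, ih m hm h1 (by omega)]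
    ring

/-- The product of the primes below `n`. -/
def primeProd (n : ℕ) : ℕ := ∏ q ∈ Finset.range n with q.Prime, q

theorem primeProd_succ (n : ℕ) :
    primeProd (n + 1) = primeProd n * if n.Prime then n else 1 := by
  rw [primeProd, Finset.range_add_one, Finset.filter_insert]
  split_ifs with h
  · rw [Finset.prod_insert (by simp), mul_comm]; rfl
  · rw [mul_one]; rfl

/-- Each of the `i` new primes is at least `m`. With the upper bound below, counts of primes in
short blocks suffice to estimate `θ`. -/
theorem primeProd_pow_le {m j i : ℕ}
    (h : Nat.count Nat.Prime (m + j) = Nat.count Nat.Prime m + i) :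
    primeProd m * m ^ i ≤ primeProd (m + j) := by
  induction j generalizing i with
  | zero =>
    obtain rfl : i = 0 := by simpa using h
    simp
  | succ j ih =>
    rw [← add_assoc, Nat.count_succ] at h
    rw [← add_assoc, primeProd_succ]
    split_ifs at h ⊢ with hp
    · have hmono := Nat.count_monotone Nat.Prime (Nat.le_add_right m j)
      obtain ⟨i, rfl⟩ : ∃ i', i = i' + 1 := ⟨i - 1, by omega⟩
      rw [pow_succ, ← mul_assoc]
      exact Nat.mul_le_mul (ih (by omega)) (by omega)
    · rw [mul_one]
      exact ih (by omega)

theorem primeProd_le_pow {m j i M : ℕ} (hM : m + j ≤ M)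
    (h : Nat.count Nat.Prime (m + j) = Nat.count Nat.Prime m + i) :
    primeProd (m + j) ≤ primeProd m * M ^ i := by
  induction j generalizing i with
  | zero =>
    obtain rfl : i = 0 := by simpa using h
    simp
  | succ j ih =>
    rw [← add_assoc, Nat.count_succ] at h
    rw [← add_assoc, primeProd_succ]
    split_ifs at h ⊢ with hp
    · have hmono := Nat.count_monotone Nat.Prime (Nat.le_add_right m j)
      obtain ⟨i, rfl⟩ : ∃ i', i = i' + 1 := ⟨i - 1, by omega⟩
      rw [pow_succ, ← mul_assoc]
      exact Nat.mul_le_mul (ih (by omega) (by omega)) (by omega)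
    · rw [mul_one]
      exact ih (by omega) (by omega)

theorem primeWalk_succ (fin : ℕ → ℕ → ℕ → ℕ → ℕ → Bool) (t c a b l u : ℕ) :
    primeWalk fin (t + 1) c a b l u =
      (let d := Nat.log2 c - 5
       let h := 2 ^ (d + 1)
       let i := testCount d c
       let j := testCount d (3 * c) + testCount d (3 * c + h) + testCount d (3 * c + 2 * h)
       Nat.ble (c + h) 132000 && (Nat.ble (9 * (a + i)) (4 * (b + 1)) &&
        primeWalk fin t (c + h) (a + i) (b + j) (l * c ^ i) (u * (3 * (c + h)) ^ j))) := by
  simp only [primeWalk, evalThen_eq]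

theorem primeWalk_spec (fin : ℕ → ℕ → ℕ → ℕ → ℕ → Bool) (t : ℕ) : ∀ c a b l u : ℕ,
    Odd c → 29 ≤ c → a = Nat.count Nat.Prime c → b = Nat.count Nat.Prime (3 * c) →
    l ≤ primeProd c → primeProd (3 * c) ≤ u → primeWalk fin t c a b l u = true →
    ∃ c' a' b' l' u', fin c' a' b' l' u' = true ∧ a' = Nat.count Nat.Prime c' ∧
      b' = Nat.count Nat.Prime (3 * c') ∧ l' ≤ primeProd c' ∧ primeProd (3 * c') ≤ u' ∧
      ∀ x, c ≤ x → x < c' →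
        9 * Nat.count Nat.Prime (x + 1) ≤ 4 * (Nat.count Nat.Prime (3 * x) + 1) := by
  induction t with
  | zero =>
    intro c a b l u _ _ ha hb hl hu h
    exact ⟨c, a, b, l, u, h, ha, hb, hl, hu, fun x h1 h2 => by omega⟩
  | succ t ih =>
    intro c a b l u hodd hc ha hb hl hu h
    simp only [primeWalk_succ, Bool.and_eq_true, Nat.ble_eq] at h
    obtain ⟨hle, hchk, hw⟩ := h
    generalize Nat.log2 c - 5 = d at hle hchk hw
    have heven : Even (2 ^ (d + 1)) := ⟨2 ^ d, by ring⟩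
    have hpos : 0 < 2 ^ (d + 1) := by positivity
    generalize hh : 2 ^ (d + 1) = h at hle hchk hw heven hpos
    have e1 : Nat.count Nat.Prime (c + h) = Nat.count Nat.Prime c + testCount d c := by
      rw [← hh]
      exact count_add_testCount d c hodd hc (by omega)
    have ho3 : Odd (3 * c) := Odd.mul (by decide) hodd
    have e2 : Nat.count Nat.Prime (3 * c + h) =
        Nat.count Nat.Prime (3 * c) + testCount d (3 * c) := by
      rw [← hh]
      exact count_add_testCount d _ ho3 (by omega) (by omega)
    have e3 : Nat.count Nat.Prime (3 * c + h + h) =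
        Nat.count Nat.Prime (3 * c + h) + testCount d (3 * c + h) := by
      have := count_add_testCount d (3 * c + h) (ho3.add_even heven) (by omega) (by omega)
      rwa [hh] at this
    have e4 : Nat.count Nat.Prime (3 * c + h + h + h) =
        Nat.count Nat.Prime (3 * c + h + h) + testCount d (3 * c + 2 * h) := by
      have := count_add_testCount d (3 * c + h + h) ((ho3.add_even heven).add_even heven)
        (by omega) (by omega)
      rw [hh] at this
      rw [this, show 3 * c + 2 * h = 3 * c + h + h by ring]
    have e5 : Nat.count Nat.Prime (3 * c + 3 * h) = Nat.count Nat.Prime (3 * c) +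
        (testCount d (3 * c) + testCount d (3 * c + h) + testCount d (3 * c + 2 * h)) := by
      rw [show 3 * c + 3 * h = 3 * c + h + h + h by ring, e4, e3, e2]
      ring
    generalize testCount d c = i at *
    generalize testCount d (3 * c) + testCount d (3 * c + h) + testCount d (3 * c + 2 * h) = j at *
    have e6 : 3 * (c + h) = 3 * c + 3 * h := by ring
    obtain ⟨c', a', b', l', u', hf, ha', hb', hl', hu', hx⟩ :=
      ih (c + h) (a + i) (b + j) (l * c ^ i) (u * (3 * (c + h)) ^ j) (hodd.add_even heven) (by omega)
        (by rw [e1, ha]) (by rw [e6, e5, hb])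
        ((Nat.mul_le_mul_right _ hl).trans (primeProd_pow_le e1))
        (by
          rw [e6]
          exact (primeProd_le_pow le_rfl e5).trans (Nat.mul_le_mul_right _ hu)) hw
    refine ⟨c', a', b', l', u', hf, ha', hb', hl', hu', fun x h1 h2 => ?_⟩
    rcases le_or_gt (c + h) x with h3 | h3
    · exact hx x h3 h2
    -- Within a block, monotonicity reduces the claim to the count for `x` at the right end and the
    -- count for `3 * x` at the left end, which is what the walk compares.
    · have m1 := Nat.count_monotone Nat.Prime (show x + 1 ≤ c + h by omega)
      have m2 := Nat.count_monotone Nat.Prime (show 3 * c ≤ 3 * x by omega)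
      omega

/-- Two steps of length 2 lead from 29 to 33; after that each doubling takes 16 blocks, so 12
doublings reach `2 ^ 17 + 1 = 131073` after `2 + 12 * 16 = 194` steps. -/
theorem primeWalk_eq_true : primeWalk (fun c a b l u => Nat.beq c 131073 && (Nat.beq a 12251 &&
    (Nat.beq b 33335 && (Nat.ble (2 ^ 188100) l && Nat.ble u (2 ^ 567500))))) 194 29 9 23
    (primeProd 29) (primeProd 87) = true := by
  decide +kernel

theorem prime_statistics :
    Nat.count Nat.Prime 131073 = 12251 ∧ Nat.count Nat.Prime 393219 = 33335 ∧
    2 ^ 188100 ≤ primeProd 131073 ∧ primeProd 393219 ≤ 2 ^ 567500 ∧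
    ∀ x, 29 ≤ x → x < 131073 →
      9 * Nat.count Nat.Prime (x + 1) ≤ 4 * (Nat.count Nat.Prime (3 * x) + 1) := by
  obtain ⟨c, a, b, l, u, hf, ha, hb, hl, hu, hx⟩ := primeWalk_spec _ 194 29 9 23 (primeProd 29)
    (primeProd 87) (by decide) le_rfl (by decide +kernel) (by decide +kernel) le_rfl le_rfl
    primeWalk_eq_true
  simp only [Bool.and_eq_true, Nat.ble_eq, Nat.beq_eq] at hf
  obtain ⟨rfl, rfl, rfl, h1, h2⟩ := hf
  exact ⟨ha.symm, hb.symm, h1.trans hl, hu.trans h2, hx⟩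

/-! ### Chebyshev's bounds -/

open ArithmeticFunction in
theorem log_factorial_eq_sum_vonMangoldt (n : ℕ) :
    Real.log (n.factorial : ℝ) = ∑ d ∈ Finset.Ioc 0 n, vonMangoldt d * ((n / d : ℕ) : ℝ) := by
  induction n with
  | zero => simp
  | succ n ih =>
    have h1 : ∑ d ∈ Finset.Ioc 0 (n + 1), vonMangoldt d * ((n / d : ℕ) : ℝ) =
        ∑ d ∈ Finset.Ioc 0 n, vonMangoldt d * ((n / d : ℕ) : ℝ) := by
      rw [← Finset.insert_Ioc_right_eq_Ioc_add_one (by omega), Finset.sum_insert (by simp)]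
      simp [Nat.div_eq_of_lt]
    have h2 : ∑ d ∈ Finset.Ioc 0 (n + 1), vonMangoldt d * (if d ∣ n + 1 then (1 : ℝ) else 0) =
        Real.log ((n + 1 : ℕ) : ℝ) := by
      rw [← vonMangoldt_sum, Nat.divisors, Finset.sum_filter]
      simp only [mul_ite, mul_one, mul_zero]
      rfl
    have h3 : ∀ d, ((((n + 1) / d : ℕ)) : ℝ) = ((n / d : ℕ) : ℝ) + if d ∣ n + 1 then 1 else 0 := by
      intro d
      rw [Nat.succ_div]
      push_cast
      rfl
    simp only [h3, mul_add, Finset.sum_add_distrib]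
    rw [h1, h2, ← ih, Nat.factorial_succ, Nat.cast_mul, Real.log_mul (by positivity) (by positivity)]
    ring

open ArithmeticFunction in
theorem log_factorial_div_eq_sum_vonMangoldt (n k : ℕ) :
    Real.log ((n / k).factorial : ℝ) =
      ∑ d ∈ Finset.Ioc 0 n, vonMangoldt d * ((n / d / k : ℕ) : ℝ) := by
  rw [log_factorial_eq_sum_vonMangoldt]
  have h : ∀ d, n / k / d = n / d / k := fun d => by
    rw [Nat.div_div_eq_div_mul, Nat.div_div_eq_div_mul, mul_comm]
  simp only [h]
  refine Finset.sum_subset (Finset.Ioc_subset_Ioc_right (Nat.div_le_self _ _)) fun d hd hd' => ?_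
  rw [Finset.mem_Ioc] at hd hd'
  rw [← h, Nat.div_eq_of_lt (by omega)]
  simp

/-- The logarithm of Chebyshev's quotient of factorials. -/
noncomputable def chebyshevLog (n : ℕ) : ℝ :=
  Real.log (n.factorial : ℝ) + Real.log ((n / 30).factorial : ℝ) -
    Real.log ((n / 2).factorial : ℝ) - Real.log ((n / 3).factorial : ℝ) -
    Real.log ((n / 5).factorial : ℝ)

open ArithmeticFunction in
theorem chebyshevLog_eq_sum (n : ℕ) :
    chebyshevLog n = ∑ d ∈ Finset.Ioc 0 n, vonMangoldt d *
      (((n / d : ℕ) : ℝ) + ((n / d / 30 : ℕ) : ℝ) - ((n / d / 2 : ℕ) : ℝ) - ((n / d / 3 : ℕ) : ℝ) -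
        ((n / d / 5 : ℕ) : ℝ)) := by
  simp only [chebyshevLog, log_factorial_div_eq_sum_vonMangoldt n 30,
    log_factorial_div_eq_sum_vonMangoldt n 2, log_factorial_div_eq_sum_vonMangoldt n 3,
    log_factorial_div_eq_sum_vonMangoldt n 5, log_factorial_eq_sum_vonMangoldt n,
    ← Finset.sum_add_distrib, ← Finset.sum_sub_distrib]
  exact Finset.sum_congr rfl fun d _ => by ring

open ArithmeticFunction in
theorem psi_natCast (n : ℕ) : Chebyshev.psi n = ∑ d ∈ Finset.Ioc 0 n, vonMangoldt d := by
  rw [Chebyshev.psi, Nat.floor_natCast]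

open ArithmeticFunction in
-- The coefficient `k + k/30 - k/2 - k/3 - k/5` (integer divisions) of `Λ(d)`, with `k = n / d`,
-- never exceeds 1.
theorem chebyshevLog_le_psi (n : ℕ) : chebyshevLog n ≤ Chebyshev.psi n := by
  rw [chebyshevLog_eq_sum, psi_natCast]
  refine Finset.sum_le_sum fun d _ => mul_le_of_le_one_right vonMangoldt_nonneg ?_
  generalize n / d = k
  have h : k + k / 30 ≤ 1 + k / 2 + k / 3 + k / 5 := by omega
  have h' : (k : ℝ) + (k / 30 : ℕ) ≤ 1 + (k / 2 : ℕ) + (k / 3 : ℕ) + (k / 5 : ℕ) := mod_cast h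
  linarith

open ArithmeticFunction in
-- The same coefficient is never negative, and it is at least 1 for `1 ≤ k < 6`, that is for `n / 6
-- < d ≤ n`.
theorem psi_sub_psi_le_chebyshevLog (n : ℕ) :
    Chebyshev.psi n - Chebyshev.psi (n / 6 : ℕ) ≤ chebyshevLog n := by
  rw [chebyshevLog_eq_sum, psi_natCast, psi_natCast]
  have hsub : Finset.Ioc 0 (n / 6) ⊆ Finset.Ioc 0 n :=
    Finset.Ioc_subset_Ioc_right (Nat.div_le_self _ _)
  rw [← Finset.sum_sdiff_eq_sub hsub]
  refine (Finset.sum_le_sum fun d hd => ?_).trans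
    (Finset.sum_le_sum_of_subset_of_nonneg Finset.sdiff_subset fun d _ _ => ?_)
  · rw [Finset.mem_sdiff, Finset.mem_Ioc, Finset.mem_Ioc] at hd
    refine le_mul_of_one_le_right vonMangoldt_nonneg ?_
    have h1 : 1 ≤ n / d := (Nat.one_le_div_iff hd.1.1).2 hd.1.2
    have h2 : n / d < 6 := (Nat.div_lt_iff_lt_mul hd.1.1).2 (by omega)
    generalize n / d = k at *
    have h : 1 + k / 2 + k / 3 + k / 5 ≤ k + k / 30 := by omega
    have h' : 1 + ((k / 2 : ℕ) : ℝ) + (k / 3 : ℕ) + (k / 5 : ℕ) ≤ k + (k / 30 : ℕ) := mod_cast h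
    linarith
  · refine mul_nonneg vonMangoldt_nonneg ?_
    generalize n / d = k
    have h : k / 2 + k / 3 + k / 5 ≤ k + k / 30 := by omega
    have h' : ((k / 2 : ℕ) : ℝ) + (k / 3 : ℕ) + (k / 5 : ℕ) ≤ k + (k / 30 : ℕ) := mod_cast h
    linarith

theorem mul_log_sub_le_log_factorial {n : ℕ} (hn : 0 < n) :
    n * Real.log n - n + 1 ≤ Real.log (n.factorial : ℝ) := by
  induction n, hn using Nat.le_induction with
  | base => simp
  | succ n hn ih =>
    have hn' : (0 : ℝ) < n := by exact_mod_cast hn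
    rw [Nat.factorial_succ, Nat.cast_mul, Real.log_mul (by positivity) (by positivity)]
    have h := Real.log_le_sub_one_of_pos (show 0 < ((n : ℝ) + 1) / n by positivity)
    rw [Real.log_div (by positivity) (by positivity)] at h
    have h2 : (n : ℝ) * (Real.log (n + 1) - Real.log n) ≤ 1 := by
      calc (n : ℝ) * (Real.log (n + 1) - Real.log n) ≤ n * (((n : ℝ) + 1) / n - 1) := by gcongr
        _ = 1 := by field_simp; ring
    push_cast
    nlinarith

theorem log_factorial_le {n : ℕ} (hn : 0 < n) :
    Real.log (n.factorial : ℝ) ≤ n * Real.log n - n + 1 + Real.log n := by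
  induction n, hn using Nat.le_induction with
  | base => simp
  | succ n hn ih =>
    have hn' : (0 : ℝ) < n := by exact_mod_cast hn
    rw [Nat.factorial_succ, Nat.cast_mul, Real.log_mul (by positivity) (by positivity)]
    have h := Real.log_le_sub_one_of_pos (show 0 < (n : ℝ) / (n + 1) by positivity)
    rw [Real.log_div (by positivity) (by positivity)] at h
    have h2 : ((n : ℝ) + 1) * (Real.log n - Real.log (n + 1)) ≤ -1 := by
      calc ((n : ℝ) + 1) * (Real.log n - Real.log (n + 1)) ≤ (n + 1) * ((n : ℝ) / (n + 1) - 1) := by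
            gcongr
        _ = -1 := by field_simp; ring
    push_cast
    nlinarith

/-- The function `x * log x - x` grows on `[1, ∞)`. -/
theorem mul_log_sub_self_le {x y : ℝ} (hx : 1 ≤ x) (hxy : x ≤ y) :
    x * Real.log x - x ≤ y * Real.log y - y := by
  have hx0 : 0 < x := by linarith
  have hy0 : 0 < y := by linarith
  have h := Real.log_le_sub_one_of_pos (show 0 < x / y by positivity)
  rw [Real.log_div hx0.ne' hy0.ne'] at h
  have h2 : y * (Real.log x - Real.log y) ≤ x - y := by
    calc y * (Real.log x - Real.log y) ≤ y * (x / y - 1) := by gcongr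
      _ = x - y := by field_simp
  have h3 := mul_nonneg (sub_nonneg.2 hxy) (Real.log_nonneg hx)
  nlinarith

theorem neg_one_le_mul_log_sub_self {x : ℝ} (hx : 0 < x) : -1 ≤ x * Real.log x - x := by
  have h := Real.log_le_sub_one_of_pos (inv_pos.2 hx)
  rw [Real.log_inv] at h
  have h2 : x * (-Real.log x) ≤ x * (x⁻¹ - 1) := by gcongr
  have h3 : x * (x⁻¹ - 1) = 1 - x := by field_simp
  linarith

theorem log_factorial_div_le {n k : ℕ} (hn : 0 < n) (hk : 0 < k) :
    Real.log ((n / k).factorial : ℝ) ≤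
      (n / k : ℝ) * Real.log (n / k) - n / k + 1 + Real.log n := by
  have hn' : (1 : ℝ) ≤ n := by exact_mod_cast hn
  have hk' : (0 : ℝ) < k := by exact_mod_cast hk
  have hlog := Real.log_nonneg hn'
  rcases Nat.eq_zero_or_pos (n / k) with h | h
  · rw [h, Nat.factorial_zero, Nat.cast_one, Real.log_one]
    linarith [neg_one_le_mul_log_sub_self (show 0 < (n / k : ℝ) by positivity)]
  · have h1 : (1 : ℝ) ≤ ((n / k : ℕ) : ℝ) := by exact_mod_cast h
    have h2 : Real.log ((n / k : ℕ) : ℝ) ≤ Real.log n :=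
      Real.log_le_log (by linarith) (by exact_mod_cast Nat.div_le_self n k)
    linarith [log_factorial_le h, mul_log_sub_self_le h1 Nat.cast_div_le]

theorem le_log_factorial_div {n k : ℕ} (hk : 2 ≤ k) (hn : 2 ≤ n) :
    (n / k : ℝ) * Real.log (n / k) - n / k - Real.log n ≤ Real.log ((n / k).factorial : ℝ) := by
  have hn' : (2 : ℝ) ≤ n := by exact_mod_cast hn
  have hk' : (2 : ℝ) ≤ k := by exact_mod_cast hk
  have hfl : (n / k : ℝ) < (n / k : ℕ) + 1 := by
    rw [div_lt_iff₀ (by positivity)]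
    have := Nat.lt_mul_div_succ n (show 0 < k by omega)
    rw [mul_comm]
    exact_mod_cast this
  have hlog := Real.log_nonneg (show (1 : ℝ) ≤ n by linarith)
  have hpos : 0 < (n / k : ℝ) := by positivity
  rcases lt_or_ge (n / k : ℝ) 1 with h | h
  · have h1 := Real.log_nonpos hpos.le h.le
    have h2 : 0 ≤ Real.log ((n / k).factorial : ℝ) :=
      Real.log_nonneg (by exact_mod_cast Nat.factorial_pos _)
    nlinarith
  -- The bound is taken at `n / k + 1`, which exceeds the real quotient; removing the last factor of
  -- that factorial costs at most `log n`.
  · have h1 := mul_log_sub_self_le h hfl.le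
    have h2 := mul_log_sub_le_log_factorial (Nat.succ_pos (n / k))
    rw [Nat.succ_eq_add_one, Nat.factorial_succ, Nat.cast_mul,
      Real.log_mul (by positivity) (by positivity)] at h2
    push_cast at h2
    have h3 : ((n / k : ℕ) : ℝ) + 1 ≤ n := by
      have : n / k + 1 ≤ n := by
        have := Nat.div_lt_self (show 0 < n by omega) (show 1 < k by omega)
        omega
      exact_mod_cast this
    have h4 := Real.log_le_log (by positivity) h3
    linarith

/-- Chebyshev's constant, `0.92129…`. -/
noncomputable def chebyshevConst : ℝ :=
  14 / 30 * Real.log 2 + 9 / 30 * Real.log 3 + 5 / 30 * Real.log 5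

/-- Since `1 + 1/30 = 1/2 + 1/3 + 1/5`, the terms in `x log x` and `x` cancel. -/
theorem chebyshevConst_mul_eq {x : ℝ} (hx : 0 < x) :
    chebyshevConst * x = (x * Real.log x - x) + ((x / 30) * Real.log (x / 30) - x / 30) -
      ((x / 2) * Real.log (x / 2) - x / 2) - ((x / 3) * Real.log (x / 3) - x / 3) -
      ((x / 5) * Real.log (x / 5) - x / 5) := by
  have h30 : Real.log 30 = Real.log 2 + Real.log 3 + Real.log 5 := by
    rw [← Real.log_mul (by norm_num) (by norm_num), ← Real.log_mul (by norm_num) (by norm_num)]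
    norm_num
  rw [Real.log_div hx.ne' (by norm_num), Real.log_div hx.ne' (by norm_num),
    Real.log_div hx.ne' (by norm_num), Real.log_div hx.ne' (by norm_num), h30, chebyshevConst]
  ring

theorem chebyshevLog_le {n : ℕ} (hn : 2 ≤ n) :
    chebyshevLog n ≤ chebyshevConst * n + 5 * Real.log n + 2 := by
  have h0 : (0 : ℝ) < n := by positivity
  have h1 := log_factorial_le (show 0 < n by omega)
  have h2 := log_factorial_div_le (k := 30) (show 0 < n by omega) (by norm_num)
  have h3 := le_log_factorial_div (k := 2) (by norm_num) hn
  have h4 := le_log_factorial_div (k := 3) (by norm_num) hn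
  have h5 := le_log_factorial_div (k := 5) (by norm_num) hn
  push_cast at h2 h3 h4 h5
  rw [chebyshevConst_mul_eq h0, chebyshevLog]
  linarith

theorem le_chebyshevLog {n : ℕ} (hn : 2 ≤ n) :
    chebyshevConst * n - 4 * Real.log n - 3 ≤ chebyshevLog n := by
  have h0 : (0 : ℝ) < n := by positivity
  have h1 := mul_log_sub_le_log_factorial (show 0 < n by omega)
  have h2 := le_log_factorial_div (k := 30) (by norm_num) hn
  have h3 := log_factorial_div_le (k := 2) (show 0 < n by omega) (by norm_num)
  have h4 := log_factorial_div_le (k := 3) (show 0 < n by omega) (by norm_num)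
  have h5 := log_factorial_div_le (k := 5) (show 0 < n by omega) (by norm_num)
  push_cast at h2 h3 h4 h5
  rw [chebyshevConst_mul_eq h0, chebyshevLog]
  linarith

theorem div_mul_log_le_log {a b k m : ℕ} (ha : 1 < a) (hm : 0 < m) (h : a ^ k ≤ b ^ m) :
    (k : ℝ) / m * Real.log a ≤ Real.log b := by
  have h1 : Real.log ((a : ℝ) ^ k) ≤ Real.log ((b : ℝ) ^ m) :=
    Real.log_le_log (by positivity) (by exact_mod_cast h)
  rw [Real.log_pow, Real.log_pow] at h1
  have hm' : (0 : ℝ) < m := by exact_mod_cast hm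
  rw [div_mul_eq_mul_div, div_le_iff₀ hm']
  linarith

theorem log_le_div_mul_log {a b k m : ℕ} (hb : 0 < b) (hm : 0 < m)
    (h : b ^ m ≤ a ^ k) : Real.log b ≤ (k : ℝ) / m * Real.log a := by
  have h1 : Real.log ((b : ℝ) ^ m) ≤ Real.log ((a : ℝ) ^ k) :=
    Real.log_le_log (by positivity) (by exact_mod_cast h)
  rw [Real.log_pow, Real.log_pow] at h1
  have hm' : (0 : ℝ) < m := by exact_mod_cast hm
  rw [div_mul_eq_mul_div, le_div_iff₀ hm']
  linarith

/-- Comparing powers of 2 with powers of 3 and 5 gives rational approximations to `log 3 / log 2`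
and `log 5 / log 2`. -/
theorem lt_chebyshevConst : 0.9212 < chebyshevConst := by
  have h2 := Real.log_two_gt_d9
  have h3 := div_mul_log_le_log (a := 2) (b := 3) (k := 84) (m := 53) (by norm_num) (by norm_num) (by norm_num)
  have h5 := div_mul_log_le_log (a := 2) (b := 5) (k := 65) (m := 28) (by norm_num) (by norm_num) (by norm_num)
  push_cast at h3 h5
  rw [chebyshevConst]
  linarith

theorem chebyshevConst_lt : chebyshevConst < 0.9214 := by
  have h2 := Real.log_two_lt_d9
  have h3 := log_le_div_mul_log (a := 2) (b := 3) (k := 65) (m := 41) (by norm_num) (by norm_num) (by norm_num)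
  have h5 := log_le_div_mul_log (a := 2) (b := 5) (k := 137) (m := 59) (by norm_num) (by norm_num) (by norm_num)
  push_cast at h3 h5
  rw [chebyshevConst]
  linarith

theorem lt_log_six : 1.79 < Real.log 6 ∧ Real.log 6 < 1.8 := by
  have h2 := Real.log_two_lt_d9
  have h2' := Real.log_two_gt_d9
  have h := div_mul_log_le_log (a := 2) (b := 6) (k := 31) (m := 12) (by norm_num) (by norm_num) (by norm_num)
  have h' := log_le_div_mul_log (a := 2) (b := 6) (k := 44) (m := 17) (by norm_num) (by norm_num) (by norm_num)
  push_cast at h h'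
  constructor <;> linarith

/-- Iterating `ψ(n) - ψ(n/6) ≤ A n + 5 log n + 2` gives the factor `1 / (1 - 1/6) = 1.2`. Passing to
`n / 6` lowers `1.4 log² n` by about `2.8 * log 6 * log n`, and `2.8 * 1.79 > 5` absorbs the term `5
log n`. -/
theorem psi_natCast_le (n : ℕ) :
    Chebyshev.psi n ≤ 1.2 * chebyshevConst * n + 1.4 * Real.log n ^ 2 + 4 * Real.log n + 4 := by
  have hA := lt_chebyshevConst
  induction n using Nat.strong_induction_on with
  | _ n ih =>
    rcases lt_or_ge n 2 with hn | hn
    · have h0 : Chebyshev.psi n = 0 :=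
        Chebyshev.psi_eq_zero_of_lt_two (by exact_mod_cast hn)
      have h1 := Real.log_natCast_nonneg n
      rw [h0]
      positivity
    · have h0 : (2 : ℝ) ≤ n := by exact_mod_cast hn
      have h1 := psi_sub_psi_le_chebyshevLog n
      have h2 := chebyshevLog_le hn
      have h3 := Real.log_natCast_nonneg n
      rcases lt_or_ge n 6 with h6 | h6
      · rw [Nat.div_eq_of_lt h6, Nat.cast_zero, Chebyshev.psi_zero] at h1
        have h4 : Real.log n ≤ Real.log 6 :=
          Real.log_le_log (by positivity) (by exact_mod_cast h6.le)
        have h5 := lt_log_six.2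
        nlinarith
      · have h4 := ih (n / 6) (by omega)
        have h5 : ((n / 6 : ℕ) : ℝ) ≤ n / 6 := by exact_mod_cast Nat.cast_div_le (m := n) (n := 6)
        have h7 : (0 : ℝ) < (n / 6 : ℕ) := by
          have : 0 < n / 6 := by omega
          exact_mod_cast this
        have h8 := Real.log_le_log h7 h5
        rw [Real.log_div (by positivity) (by norm_num)] at h8
        have h9 := Real.log_natCast_nonneg (n / 6)
        have h10 : Real.log (n / 6 : ℕ) ^ 2 ≤ (Real.log n - Real.log 6) ^ 2 := by gcongr
        have h11 : chebyshevConst * ((n / 6 : ℕ) : ℝ) ≤ chebyshevConst * (n / 6) := by gcongr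
        obtain ⟨l1, l2⟩ := lt_log_six
        have h12 : 1.79 * Real.log n ≤ Real.log 6 * Real.log n := by gcongr
        nlinarith

/-! ### Comparison of `π (3 * x)` with `π x` -/

theorem log_le_and_log_sq_le {n : ℕ} (hn : 131072 ≤ n) :
    Real.log n ≤ 0.00009 * n ∧ Real.log n ^ 2 ≤ 0.00107 * n := by
  have hn' : (131072 : ℝ) ≤ n := by exact_mod_cast hn
  -- With `n = 2^17 r²` and `log r ≤ r - 1`, `log n` is at most `11.79 r`, hence `log² n` is linear
  -- in `n`.
  obtain ⟨r, hr, hrn⟩ : ∃ r : ℝ, 1 ≤ r ∧ (n : ℝ) = 2 ^ 17 * r ^ 2 := by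
    refine ⟨√(n / 2 ^ 17), ?_, ?_⟩
    · rw [Real.one_le_sqrt, one_le_div (by positivity)]
      linarith
    · rw [Real.sq_sqrt (by positivity)]
      field_simp
  have h1 : Real.log n = 17 * Real.log 2 + 2 * Real.log r := by
    rw [hrn, Real.log_mul (by positivity) (by positivity), Real.log_pow, Real.log_pow]
    norm_num
  have h2 := Real.log_two_lt_d9
  have h3 := Real.log_le_sub_one_of_pos (show 0 < r by linarith)
  have h4 : Real.log n ≤ 11.79 * r := by linarith
  have h5 := Real.log_natCast_nonneg n
  rw [hrn]
  rw [hrn] at h4 h5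
  constructor
  · nlinarith
  · calc _ ≤ (11.79 * r) ^ 2 := by gcongr
      _ ≤ _ := by nlinarith

theorem theta_le {n : ℕ} (hn : 131072 ≤ n) : Chebyshev.theta n ≤ 1.109 * n := by
  have hn' : (131072 : ℝ) ≤ n := by exact_mod_cast hn
  have h1 := Chebyshev.theta_le_psi n
  have h2 := psi_natCast_le n
  have h3 := chebyshevConst_lt
  obtain ⟨h4, h5⟩ := log_le_and_log_sq_le hn
  have h6 : chebyshevConst * n ≤ 0.9214 * n := by gcongr
  linarith

theorem le_theta {n : ℕ} (hn : 393216 ≤ n) : 0.9135 * n ≤ Chebyshev.theta n := by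
  have hn' : (393216 : ℝ) ≤ n := by exact_mod_cast hn
  have h1 := Chebyshev.psi_sub_theta_le_psi_add_psi_add_psi n
  have h2 := (le_chebyshevLog (show 2 ≤ n by omega)).trans (chebyshevLog_le_psi n)
  have h3 := lt_chebyshevConst
  have h3' := chebyshevConst_lt
  obtain ⟨h4, h5⟩ := log_le_and_log_sq_le (show 131072 ≤ n by omega)
  have hone : (1 : ℝ) ≤ n := by linarith
  have h6 : Chebyshev.psi ((n : ℝ) ^ (3 : ℝ)⁻¹) ≤ Chebyshev.psi ((n : ℝ) ^ (2 : ℝ)⁻¹) :=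
    Chebyshev.psi_mono (Real.rpow_le_rpow_of_exponent_le hone (by norm_num))
  have h7 : Chebyshev.psi ((n : ℝ) ^ (5 : ℝ)⁻¹) ≤ Chebyshev.psi ((n : ℝ) ^ (2 : ℝ)⁻¹) :=
    Chebyshev.psi_mono (Real.rpow_le_rpow_of_exponent_le hone (by norm_num))
  have hs : (n : ℝ) ^ (2 : ℝ)⁻¹ = √n := by rw [Real.sqrt_eq_rpow]; norm_num
  rw [hs] at h1 h6 h7
  have hsq : √(n : ℝ) * √(n : ℝ) = n := Real.mul_self_sqrt (by positivity)
  -- `627² = 393129`. The three `ψ` terms bounding `ψ - θ` are each at most `ψ(√n)`, and `√n ≤ n /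
  -- 627`.
  have h627 : 627 ≤ √(n : ℝ) := Real.le_sqrt_of_sq_le (by linarith)
  have h8 := Chebyshev.psi_eq_psi_coe_floor √(n : ℝ)
  have h9 := psi_natCast_le ⌊√(n : ℝ)⌋₊
  have h10 : (⌊√(n : ℝ)⌋₊ : ℝ) ≤ √n := Nat.floor_le (by positivity)
  have h11 : 0 < ⌊√(n : ℝ)⌋₊ := Nat.floor_pos.2 (by linarith)
  have h12 : Real.log ⌊√(n : ℝ)⌋₊ ≤ Real.log n / 2 := by
    rw [← Real.log_sqrt (by positivity)]
    exact Real.log_le_log (by exact_mod_cast h11) h10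
  have h13 := Real.log_natCast_nonneg ⌊√(n : ℝ)⌋₊
  have h14 : Real.log ⌊√(n : ℝ)⌋₊ ^ 2 ≤ (Real.log n / 2) ^ 2 := by gcongr
  have h15 : chebyshevConst * (⌊√(n : ℝ)⌋₊ : ℝ) ≤ 0.9214 * √n := by gcongr
  have h16 : 627 * √(n : ℝ) ≤ n := by nlinarith
  have h17 : 0.9212 * (n : ℝ) ≤ chebyshevConst * n := by gcongr
  linarith

/-- The sum of `1 / log k` over `2 ≤ k ≤ n`. -/
noncomputable def logSum (n : ℕ) : ℝ := ∑ k ∈ Finset.range (n + 1), 1 / Real.log k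

theorem logSum_succ (n : ℕ) : logSum (n + 1) = logSum n + 1 / Real.log (n + 1 : ℕ) := by
  rw [logSum, Finset.sum_range_succ, ← logSum]

/-- Summation by parts compares `π n` with `c * logSum n`, up to this quantity. -/
noncomputable def abelDefect (c : ℝ) (n : ℕ) : ℝ :=
  (Nat.primeCounting n : ℝ) - (Chebyshev.theta n - c * n) / Real.log n - c * logSum n

theorem primeCounting_succ (n : ℕ) :
    Nat.primeCounting (n + 1) = Nat.primeCounting n + if (n + 1).Prime then 1 else 0 :=
  Nat.count_succ _ _

theorem theta_succ (n : ℕ) : Chebyshev.theta (n + 1 : ℕ) =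
    Chebyshev.theta n + if (n + 1).Prime then Real.log (n + 1 : ℕ) else 0 := by
  rw [Chebyshev.theta, Chebyshev.theta, Nat.floor_natCast, Nat.floor_natCast,
    ← Finset.insert_Ioc_right_eq_Ioc_add_one (by omega), Finset.filter_insert]
  split_ifs with h
  · rw [Finset.sum_insert (by simp)]
    ring
  · ring

/-- A prime `n + 1` adds 1 to `π` and `log (n + 1) / log (n + 1)` to the quotient, which cancel, and
so do the terms with `c`. The defect is therefore monotone while `θ` stays on one side of `c n`. -/
theorem abelDefect_succ_sub (c : ℝ) {n : ℕ} (hn : 2 ≤ n) :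
    abelDefect c (n + 1) - abelDefect c n =
      (Chebyshev.theta n - c * n) * (1 / Real.log n - 1 / Real.log (n + 1 : ℕ)) := by
  have h1 : Real.log (n + 1 : ℕ) ≠ 0 :=
    (Real.log_pos (by exact_mod_cast (show 1 < n + 1 by omega))).ne'
  rw [abelDefect, abelDefect, logSum_succ, primeCounting_succ, theta_succ]
  split_ifs
  · push_cast at h1 ⊢
    field_simp
    ring
  · push_cast at h1 ⊢
    field_simp
    ring

theorem one_div_log_sub_one_div_log_succ_nonneg {n : ℕ} (hn : 2 ≤ n) :
    0 ≤ 1 / Real.log n - 1 / Real.log (n + 1 : ℕ) := by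
  have h1 : 0 < Real.log n := Real.log_pos (by exact_mod_cast (show 1 < n by omega))
  rw [sub_nonneg]
  refine one_div_le_one_div_of_le h1 (Real.log_le_log (by positivity) ?_)
  exact_mod_cast Nat.le_succ n

theorem abelDefect_le_of_le_theta {c : ℝ} {m : ℕ} (hm : 2 ≤ m)
    (h : ∀ n : ℕ, m ≤ n → c * n ≤ Chebyshev.theta n) {n : ℕ} (hn : m ≤ n) :
    abelDefect c m ≤ abelDefect c n := by
  induction n, hn using Nat.le_induction with
  | base => rfl
  | succ n hn ih =>
    have h1 := abelDefect_succ_sub c (hm.trans hn)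
    have h2 := mul_nonneg (sub_nonneg.2 (h n hn)) (one_div_log_sub_one_div_log_succ_nonneg (hm.trans hn))
    linarith

theorem le_abelDefect_of_theta_le {c : ℝ} {m : ℕ} (hm : 2 ≤ m)
    (h : ∀ n : ℕ, m ≤ n → Chebyshev.theta n ≤ c * n) {n : ℕ} (hn : m ≤ n) :
    abelDefect c n ≤ abelDefect c m := by
  induction n, hn using Nat.le_induction with
  | base => rfl
  | succ n hn ih =>
    have h1 := abelDefect_succ_sub c (hm.trans hn)
    have h2 := mul_nonneg (sub_nonneg.2 (h n hn)) (one_div_log_sub_one_div_log_succ_nonneg (hm.trans hn))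
    linarith

theorem log_three_lt : Real.log 3 < 1.0989 := by
  have h2 := Real.log_two_lt_d9
  have h3 := log_le_div_mul_log (a := 2) (b := 3) (k := 65) (m := 41) (by norm_num) (by norm_num)
    (by norm_num)
  push_cast at h3
  linarith

theorem le_log_of_large {n : ℕ} (hn : 131072 ≤ n) : 11.7835 ≤ Real.log n := by
  have h2 := Real.log_two_gt_d9
  have h3 := Real.log_le_log (by norm_num)
    (show (2 : ℝ) ^ 17 ≤ n by norm_num; exact_mod_cast hn)
  rw [Real.log_pow] at h3
  push_cast at h3
  linarith

/-- One step in `n` adds three terms, each at least `1 / log (3n + 3)`, to the first sum and one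
term `1 / log (n + 1)` to the second. The comparison needs `log (n + 1)` above about 11.18, which `2
^ 17` ensures and `2 ^ 16` would not. -/
theorem logSum_three_mul_sub_le {m n : ℕ} (hm : 131072 ≤ m) (hn : m ≤ n) :
    0.9135 * logSum (3 * m) - 9 / 4 * 1.109 * logSum m ≤
      0.9135 * logSum (3 * n) - 9 / 4 * 1.109 * logSum n := by
  induction n, hn using Nat.le_induction with
  | base => rfl
  | succ n hn ih =>
    refine ih.trans ?_
    have h0 := le_log_of_large (show 131072 ≤ n + 1 by omega)
    have h3 := log_three_lt
    have hlog : Real.log (3 * n + 2 + 1 : ℕ) = Real.log 3 + Real.log (n + 1 : ℕ) := by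
      rw [← Real.log_mul (by norm_num) (by positivity)]
      push_cast
      ring_nf
    have h30 : 0 < Real.log 3 := Real.log_pos (by norm_num)
    have hle : ∀ k : ℕ, 2 ≤ k → k ≤ 3 * n + 2 + 1 →
        1 / (Real.log 3 + Real.log (n + 1 : ℕ)) ≤ 1 / Real.log k := by
      intro k hk hk'
      rw [← hlog]
      exact one_div_le_one_div_of_le (Real.log_pos (by exact_mod_cast (show 1 < k by omega)))
        (Real.log_le_log (by positivity) (by exact_mod_cast hk'))
    have e : logSum (3 * (n + 1)) = logSum (3 * n) + 1 / Real.log (3 * n + 1 : ℕ) +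
        1 / Real.log (3 * n + 1 + 1 : ℕ) + 1 / Real.log (3 * n + 2 + 1 : ℕ) := by
      rw [show 3 * (n + 1) = 3 * n + 1 + 1 + 1 by ring, logSum_succ, logSum_succ, logSum_succ]
    have l1 := hle (3 * n + 1) (by omega) (by omega)
    have l2 := hle (3 * n + 1 + 1) (by omega) (by omega)
    have l3 := hle (3 * n + 2 + 1) (by omega) le_rfl
    have key : 9 / 4 * 1.109 * (1 / Real.log (n + 1 : ℕ)) ≤
        3 * 0.9135 * (1 / (Real.log 3 + Real.log (n + 1 : ℕ))) := by
      generalize Real.log (n + 1 : ℕ) = L at *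
      rw [mul_one_div, mul_one_div, div_le_div_iff₀ (by linarith) (by linarith)]
      nlinarith
    rw [e, logSum_succ]
    linarith

theorem theta_natCast (n : ℕ) : Chebyshev.theta n = Real.log (primeProd (n + 1)) := by
  rw [Chebyshev.theta_eq_log_primorial, Nat.floor_natCast]
  rfl

theorem theta_natCast_of_not_prime {n : ℕ} (h : ¬ n.Prime) :
    Chebyshev.theta n = Real.log (primeProd n) := by
  rw [theta_natCast, primeProd_succ, if_neg h, mul_one]

theorem primeCounting_of_not_prime {n : ℕ} (h : ¬ n.Prime) :
    Nat.primeCounting n = Nat.count Nat.Prime n := by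
  rw [Nat.primeCounting, Nat.primeCounting', Nat.count_succ, if_neg h, add_zero]

theorem primeProd_pos (n : ℕ) : 0 < primeProd n :=
  Finset.prod_pos fun _ hq => (Finset.mem_filter.1 hq).2.pos

theorem mul_log_two_le_log {k n : ℕ} (h : 2 ^ k ≤ n) : k * Real.log 2 ≤ Real.log n := by
  rw [← Real.log_pow]
  exact Real.log_le_log (by positivity) (by exact_mod_cast h)

theorem log_le_mul_log_two {k n : ℕ} (hn : 0 < n) (h : n ≤ 2 ^ k) :
    Real.log n ≤ k * Real.log 2 := by
  rw [← Real.log_pow]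
  exact Real.log_le_log (by positivity) (by exact_mod_cast h)

theorem le_theta_131073 : 188100 * Real.log 2 ≤ Chebyshev.theta 131073 := by
  have h := mul_log_two_le_log prime_statistics.2.2.1
  rw [← theta_natCast_of_not_prime (by norm_num)] at h
  norm_num only [Nat.cast_ofNat] at h
  exact h

theorem theta_393219_le : Chebyshev.theta 393219 ≤ 567500 * Real.log 2 := by
  have h := log_le_mul_log_two (primeProd_pos _) prime_statistics.2.2.2.1
  rw [← theta_natCast_of_not_prime (by norm_num)] at h
  norm_num only [Nat.cast_ofNat] at h
  exact h

theorem primeCounting_131073 : Nat.primeCounting 131073 = 12251 := by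
  rw [primeCounting_of_not_prime (by norm_num), prime_statistics.1]

theorem primeCounting_393219 : Nat.primeCounting 393219 = 33335 := by
  rw [primeCounting_of_not_prime (by norm_num), prime_statistics.2.1]

theorem nine_mul_primeCounting_le_of_large {n : ℕ} (hn : 131073 ≤ n) :
    9 * Nat.primeCounting n ≤ 4 * Nat.primeCounting (3 * n) := by
  have h1 := abelDefect_le_of_le_theta (c := 0.9135) (m := 393219) (by norm_num)
    (fun k hk => le_theta (by omega)) (show 393219 ≤ 3 * n by omega)
  have h2 := le_abelDefect_of_theta_le (c := 1.109) (m := 131073) (by norm_num)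
    (fun k hk => theta_le (by omega)) hn
  have h3 := logSum_three_mul_sub_le (m := 131073) (by norm_num) hn
  rw [show 3 * 131073 = 393219 by norm_num] at h3
  have h4 : 0 ≤ (Chebyshev.theta (3 * n : ℕ) - 0.9135 * (3 * n : ℕ)) / Real.log (3 * n : ℕ) :=
    div_nonneg (sub_nonneg.2 (le_theta (by omega))) (Real.log_natCast_nonneg _)
  have h5 : 0 ≤ (1.109 * (n : ℝ) - Chebyshev.theta n) / Real.log n :=
    div_nonneg (sub_nonneg.2 (theta_le (by omega))) (Real.log_natCast_nonneg _)
  have h5' : (Chebyshev.theta n - 1.109 * n) / Real.log n =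
      -((1.109 * (n : ℝ) - Chebyshev.theta n) / Real.log n) := by ring
  have h6 := le_theta_131073
  have h7 := theta_393219_le
  have l1 := Real.log_two_gt_d9
  have l2 := Real.log_two_lt_d9
  have l3 : 11.7835 ≤ Real.log 131073 := by
    exact_mod_cast le_log_of_large (n := 131073) (by norm_num)
  have l4 : 12.88 ≤ Real.log 393219 := by
    have h3 := div_mul_log_le_log (a := 2) (b := 3) (k := 84) (m := 53) (by norm_num) (by norm_num)
      (by norm_num)
    have h := Real.log_le_log (by norm_num) (show (3 : ℝ) * 2 ^ 17 ≤ 393219 by norm_num)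
    rw [Real.log_mul (by norm_num) (by norm_num), Real.log_pow] at h
    push_cast at h h3
    linarith
  have b1 : (Chebyshev.theta 393219 - 0.9135 * 393219) / Real.log 393219 ≤ 2660 := by
    rw [div_le_iff₀ (by linarith)]
    linarith
  have b2 : -((Chebyshev.theta 131073 - 1.109 * 131073) / Real.log 131073) ≤ 1275 := by
    rw [← neg_div, div_le_iff₀ (by linarith)]
    linarith
  simp only [abelDefect, primeCounting_131073, primeCounting_393219, Nat.cast_ofNat] at h1 h2
  -- The initial values leave a margin: `4 * (33335 - 2660) - 9 * (12251 + 1275) = 966`.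
  have h8 : 9 * (Nat.primeCounting n : ℝ) ≤ 4 * Nat.primeCounting (3 * n) := by
    rw [h5'] at h2
    linarith
  exact_mod_cast h8

theorem nine_mul_primeCounting_le {n : ℕ} (hn : 29 ≤ n) (h3 : ¬ (3 * n).Prime) :
    9 * Nat.primeCounting n ≤ 4 * (Nat.primeCounting (3 * n) + 1) := by
  rcases lt_or_ge n 131073 with h | h
  · rw [primeCounting_of_not_prime h3]
    exact prime_statistics.2.2.2.2 n hn h
  · have := nine_mul_primeCounting_le_of_large h
    omega

/-! ### Primes between `2n` and `3n` -/

theorem exists_prime_of_large {n : ℕ} (hn : 131073 ≤ n) :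
    ∃ q, q.Prime ∧ 2 * n < q ∧ q ≤ 3 * n := by
  by_contra! h
  have h1 := le_theta (show 393216 ≤ 3 * n by omega)
  have h2 := theta_le (show 131072 ≤ 2 * n by omega)
  have h3 : primeProd (3 * n + 1) = primeProd (2 * n + 1) := by
    have hc : Nat.count Nat.Prime (2 * n + 1 + n) = Nat.count Nat.Prime (2 * n + 1) + 0 := by
      rw [Nat.count_add, add_right_inj, Nat.count_iff_forall_not]
      intro k hk hp
      have := h _ hp (by omega)
      omega
    have h4 := primeProd_le_pow le_rfl hc
    have h5 := primeProd_pow_le hc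
    rw [show 3 * n + 1 = 2 * n + 1 + n by ring]
    rw [pow_zero, mul_one] at h4 h5
    exact le_antisymm h4 h5
  -- Without such a prime `θ(3n) = θ(2n)`, against `3 * 0.9135 > 2 * 1.109`.
  rw [theta_natCast, h3, ← theta_natCast] at h1
  have hn' : (131073 : ℝ) ≤ n := by exact_mod_cast hn
  push_cast at h1 h2
  linarith

/-- Take the first entry `b` above `2n` and its predecessor `a ≤ 2n`: then `(a + 1) / 2 ≤ n`, so `b
≤ 3n`. The starting value `q₀` need not be prime. -/
theorem exists_prime_between_of_chain (l : List ℕ) : ∀ (q₀ n : ℕ), q₀ ≤ 2 * n →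
    (∀ q ∈ l, q.Prime) → List.IsChain (fun a b => b ≤ 3 * ((a + 1) / 2)) (q₀ :: l) →
    2 * n < (q₀ :: l).getLast (by simp) → ∃ q, q.Prime ∧ 2 * n < q ∧ q ≤ 3 * n := by
  induction l with
  | nil => intro q₀ n h1 _ _ h2; simp at h2; omega
  | cons a l ih =>
    intro q₀ n h1 hp hc h2
    rw [List.isChain_cons_cons] at hc
    rcases lt_or_ge (2 * n) a with h | h
    · exact ⟨a, hp a (by simp), h, by omega⟩
    · exact ih a n h (fun q hq => hp q (by simp [hq])) hc.2 (by simpa using h2)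

theorem exists_prime_between {n : ℕ} (hn : 2 ≤ n) : ∃ q, q.Prime ∧ 2 * n < q ∧ q ≤ 3 * n := by
  rcases lt_or_ge n 131073 with h | h
  · refine exists_prime_between_of_chain [5, 7, 11, 17, 23, 31, 47, 71, 107, 157, 233, 349, 523,
      773, 1153, 1723, 2579, 3863, 5791, 8681, 13009, 19507, 29251, 43867, 65789, 98669, 147997,
      221989, 332951] 4 n (by omega) ?_ (by decide) (by simp; omega)
    simp only [List.forall_mem_cons]
    norm_num
  · exact exists_prime_of_large h

/-! ### The semigroup generated by the primes from some point on -/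

namespace PrimeSemigroup

theorem mem_S_of_prime {n q : ℕ} (hq : q.Prime) (h : p n ≤ q) : q ∈ S n :=
  AddSubmonoid.subset_closure ⟨hq, h⟩

theorem p_le_of_mem_S {n x : ℕ} (hx : x ∈ S n) (h0 : 0 < x) : p n ≤ x :=
  (eq_zero_or_p_le hx).resolve_left h0.ne'

theorem count_prime_p (n : ℕ) : Nat.count Nat.Prime (p n) = n - 1 :=
  Nat.primeCounting'_nth_eq (n - 1)

theorem p_count_prime_add_one {q : ℕ} (hq : q.Prime) : p (Nat.count Nat.Prime q + 1) = q := by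
  rw [p, Nat.add_sub_cancel, Nat.nth_count hq]

theorem p_one : p 1 = 2 := p_count_prime_add_one Nat.prime_two

theorem p_two : p 2 = 3 := by
  have h := p_count_prime_add_one Nat.prime_three
  rwa [show Nat.count Nat.Prime 3 = 1 by decide +kernel] at h

theorem p_eight : p 8 = 19 := by
  have h := p_count_prime_add_one (show Nat.Prime 19 by norm_num)
  rwa [show Nat.count Nat.Prime 19 = 7 by decide +kernel] at h

theorem three_le_p {n : ℕ} (hn : 1 < n) : 3 ≤ p n := by
  by_contra h
  have h2 := (prime_p n).two_le
  have h1 := primeCounting_p (show 0 < n by omega)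
  rw [show p n = 2 by omega, show Nat.primeCounting 2 = 1 by decide +kernel] at h1
  omega

theorem five_le_p {n : ℕ} (hn : 2 < n) : 5 ≤ p n := by
  by_contra h
  have h3 := three_le_p (show 1 < n by omega)
  have h1 := primeCounting_p (show 0 < n by omega)
  have h4 : p n ≠ 4 := fun h4 => by
    have := prime_p n
    rw [h4] at this
    exact absurd this (by norm_num)
  rw [show p n = 3 by omega, show Nat.primeCounting 3 = 2 by decide +kernel] at h1
  omega

theorem odd_of_prime_of_three_le {q : ℕ} (hq : q.Prime) (h : 3 ≤ q) : Odd q :=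
  hq.odd_of_ne_two (by omega)

theorem not_prime_three_mul {q : ℕ} (h : 2 ≤ q) : ¬ (3 * q).Prime :=
  Nat.not_prime_mul (by norm_num) (by omega)

/-- An element of `S n` is `0`, a generator, a sum of two odd primes, or at least `3 * p n`. -/
theorem mem_S_cases {n x : ℕ} (hn : 1 < n) (hx : x ∈ S n) :
    x = 0 ∨ (x.Prime ∧ p n ≤ x) ∨ (Even x ∧ 2 * p n ≤ x) ∨ 3 * p n ≤ x := by
  refine AddSubmonoid.closure_induction (motive := fun x _ =>
    x = 0 ∨ (x.Prime ∧ p n ≤ x) ∨ (Even x ∧ 2 * p n ≤ x) ∨ 3 * p n ≤ x)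
    (fun y hy => Or.inr (Or.inl hy)) (Or.inl rfl) (fun a b _ _ ha hb => ?_) hx
  have h3 := three_le_p hn
  rcases ha with rfl | ⟨ha, ha'⟩ | ⟨ha, ha'⟩ | ha
  · simpa using hb
  · rcases hb with rfl | ⟨hb, hb'⟩ | ⟨hb, hb'⟩ | hb
    · exact Or.inr (Or.inl ⟨ha, ha'⟩)
    · exact Or.inr (Or.inr (Or.inl ⟨(odd_of_prime_of_three_le ha (by omega)).add_odd
        (odd_of_prime_of_three_le hb (by omega)), by omega⟩))
    · exact Or.inr (Or.inr (Or.inr (by omega)))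
    · exact Or.inr (Or.inr (Or.inr (by omega)))
  · rcases hb with rfl | ⟨hb, hb'⟩ | ⟨hb, hb'⟩ | hb
    · exact Or.inr (Or.inr (Or.inl ⟨ha, ha'⟩))
    all_goals exact Or.inr (Or.inr (Or.inr (by omega)))
  · exact Or.inr (Or.inr (Or.inr (by omega)))

theorem mem_atoms_of_prime {n q : ℕ} (hn : 1 < n) (hq : q.Prime) (h : p n ≤ q)
    (h3 : q < 3 * p n) : q ∈ atoms n := by
  refine ⟨mem_S_of_prime hq h, hq.pos, ?_⟩
  rintro ⟨x, hx, y, hy, hx0, hy0, rfl⟩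
  have hp3 := three_le_p hn
  have hx1 := p_le_of_mem_S hx hx0
  have hy1 := p_le_of_mem_S hy hy0
  have ho := odd_of_prime_of_three_le hq (by omega)
  -- Both summands are at least `p n`, so each is below `2 * p n`, where only primes occur.
  have hx2 : x.Prime := by
    rcases mem_S_cases hn hx with h | h | h | h
    · omega
    · exact h.1
    · omega
    · omega
  have hy2 : y.Prime := by
    rcases mem_S_cases hn hy with h | h | h | h
    · omega
    · exact h.1
    · omega
    · omega
  have := (odd_of_prime_of_three_le hx2 (by omega)).add_odd
    (odd_of_prime_of_three_le hy2 (by omega))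
  exact (Nat.not_even_iff_odd.2 ho) this

/-- If `p n + 2` is not prime, then no element of `S n` strictly between `3 * p n` and
`3 * p n + 4` is decomposable. -/
theorem three_mul_add_two_mem_atoms {n : ℕ} (hn : 1 < n) (h2 : ¬ (p n + 2).Prime)
    (hq : (3 * p n + 2).Prime) : 3 * p n + 2 ∈ atoms n := by
  have hp3 := three_le_p hn
  have hpo := odd_of_prime_of_three_le (prime_p n) hp3
  rw [Nat.odd_iff] at hpo
  -- Generators other than `p n` are at least `p n + 4`, so a sum of an odd and an even element is
  -- `3 * p n` or at least `3 * p n + 4`.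
  have key : ∀ x ∈ S n, x = 0 ∨ x = p n ∨ (x % 2 = 1 ∧ p n + 4 ≤ x) ∨ x = 2 * p n ∨
      (x % 2 = 0 ∧ 2 * p n + 4 ≤ x) := by
    intro x hx
    refine AddSubmonoid.closure_induction (motive := fun x _ => x = 0 ∨ x = p n ∨
      (x % 2 = 1 ∧ p n + 4 ≤ x) ∨ x = 2 * p n ∨ (x % 2 = 0 ∧ 2 * p n + 4 ≤ x))
      (fun y hy => ?_) (Or.inl rfl) (fun a b _ _ ha hb => by omega) hx
    obtain ⟨hy1, hy2⟩ := hy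
    have hy3 := odd_of_prime_of_three_le hy1 (by omega)
    rw [Nat.odd_iff] at hy3
    have hy4 : y ≠ p n + 2 := by
      rintro rfl
      exact h2 hy1
    omega
  refine ⟨mem_S_of_prime hq (by omega), hq.pos, ?_⟩
  rintro ⟨x, hx, y, hy, hx0, hy0, h⟩
  have hx1 := p_le_of_mem_S hx hx0
  have hy1 := p_le_of_mem_S hy hy0
  have := key x hx
  have := key y hy
  omega

theorem prime_of_mem_atoms {n a : ℕ} (ha : a ∈ atoms n) : a.Prime ∧ p n ≤ a := by
  obtain ⟨h1, h2, h3⟩ := ha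
  have key : a = 0 ∨ (a.Prime ∧ p n ≤ a) ∨ ∃ x ∈ S n, ∃ y ∈ S n, 0 < x ∧ 0 < y ∧ a = x + y := by
    refine AddSubmonoid.closure_induction (motive := fun a _ => a = 0 ∨ (a.Prime ∧ p n ≤ a) ∨
      ∃ x ∈ S n, ∃ y ∈ S n, 0 < x ∧ 0 < y ∧ a = x + y) (fun y hy => Or.inr (Or.inl hy))
      (Or.inl rfl) (fun x y hx hy ihx ihy => ?_) h1
    rcases Nat.eq_zero_or_pos x with rfl | hx0
    · simpa using ihy
    rcases Nat.eq_zero_or_pos y with rfl | hy0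
    · simpa using ihx
    exact Or.inr (Or.inr ⟨x, hx, y, hy, hx0, hy0, rfl⟩)
  rcases key with h | h | h
  · omega
  · exact h
  · exact absurd h h3

/-! ### The case `n = 1` -/

theorem mem_S_one {m : ℕ} (hm : 2 ≤ m) : m ∈ S 1 := by
  have h2 : 2 ∈ S 1 := mem_S_of_prime Nat.prime_two p_one.le
  have h3 : 3 ∈ S 1 := mem_S_of_prime Nat.prime_three (p_one.le.trans (by norm_num))
  induction m using Nat.strong_induction_on with
  | _ m ih =>
    rcases Nat.lt_or_ge m 4 with h | h
    · obtain rfl | rfl : m = 2 ∨ m = 3 := by omega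
      · exact h2
      · exact h3
    · have := add_mem (ih (m - 2) (by omega) (by omega)) h2
      rwa [Nat.sub_add_cancel hm] at this

theorem gaps_one : gaps 1 = {1} := by
  ext x
  constructor
  · rintro ⟨h0, h1⟩
    by_contra h
    exact h1 (mem_S_one (by have : x ≠ 1 := h; omega))
  · rintro rfl
    exact one_mem_gaps 1

theorem f_one : f 1 = 1 := by rw [f, gaps_one, csSup_singleton]

theorem g_one : g 1 = 1 := by rw [g, gaps_one, Set.ncard_singleton]

theorem atoms_one : atoms 1 = {2, 3} := by
  have h2 : 2 ∈ atoms 1 := by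
    have := p_mem_atoms 1
    rwa [p_one] at this
  ext a
  constructor
  · intro ha
    have ha1 := prime_of_mem_atoms ha
    rw [p_one] at ha1
    by_contra h
    simp only [Set.mem_insert_iff, Set.mem_singleton_iff, not_or] at h
    exact ha.2.2 ⟨2, h2.1, a - 2, mem_S_one (by omega), by omega, by omega, by omega⟩
  · rintro (rfl | rfl)
    · exact h2
    · refine ⟨mem_S_one (by norm_num), by norm_num, ?_⟩
      rintro ⟨x, hx, y, hy, hx0, hy0, h⟩
      have hx1 := p_le_of_mem_S hx hx0
      have hy1 := p_le_of_mem_S hy hy0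
      rw [p_one] at hx1 hy1
      omega

theorem u_one : u 1 = 3 := by
  have h := isGreatest_u 1
  rw [atoms_one] at h
  refine h.unique ⟨by simp, ?_⟩
  rintro x (rfl | rfl) <;> norm_num

theorem e_one : e 1 = 2 := by rw [e, atoms_one, Set.ncard_pair (by norm_num)]

/-! ### Gaps -/

theorem p_sub_one_le_g (n : ℕ) : p n - 1 ≤ g n := by
  have h : (Set.Ico 1 (p n)).ncard ≤ (gaps n).ncard := by
    refine Set.ncard_le_ncard (fun x hx => ⟨hx.1, fun h => ?_⟩) (finite_gaps n)
    have := p_le_of_mem_S h hx.1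
    exact absurd hx.2 (by omega)
  rwa [← Finset.coe_Ico, Set.ncard_coe_finset, Nat.card_Ico] at h

theorem p_sub_one_le_f (n : ℕ) : p n - 1 ≤ f n := by
  have h2 := (prime_p n).two_le
  refine (isGreatest_f n).2 ⟨by omega, fun h => ?_⟩
  have := p_le_of_mem_S h (by omega)
  omega

/-! ### Atoms -/

theorem card_primes_Ico {a b : ℕ} (h : a ≤ b) :
    ((Finset.Ico a b).filter Nat.Prime).card + Nat.count Nat.Prime a = Nat.count Nat.Prime b := by
  rw [Nat.count_eq_card_filter_range, Nat.count_eq_card_filter_range, Finset.range_eq_Ico,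
    Finset.range_eq_Ico, ← Finset.card_union_of_disjoint, ← Finset.filter_union, Finset.union_comm,
    Finset.Ico_union_Ico_eq_Ico (Nat.zero_le a) h]
  exact Finset.disjoint_filter_filter (Finset.Ico_disjoint_Ico_consecutive 0 a b).symm

theorem coe_primes_Ico_subset_atoms {n : ℕ} (hn : 1 < n) :
    (((Finset.Ico (p n) (3 * p n)).filter Nat.Prime : Finset ℕ) : Set ℕ) ⊆ atoms n := by
  intro q hq
  rw [Finset.mem_coe, Finset.mem_filter, Finset.mem_Ico] at hq
  exact mem_atoms_of_prime hn hq.2 hq.1.1 hq.1.2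

theorem primeCounting_three_mul_p (n : ℕ) : Nat.primeCounting (3 * p n) =
    ((Finset.Ico (p n) (3 * p n)).filter Nat.Prime).card + (n - 1) := by
  rw [primeCounting_of_not_prime (not_prime_three_mul (prime_p n).two_le),
    ← card_primes_Ico (show p n ≤ 3 * p n by omega), count_prime_p]

theorem primeCounting_lt_e_add {n : ℕ} (hn : 1 < n) :
    Nat.primeCounting (3 * p n) < e n + n := by
  have h := Set.ncard_le_ncard (coe_primes_Ico_subset_atoms hn) (finite_atoms n)
  rw [Set.ncard_coe_finset] at h
  rw [primeCounting_three_mul_p, e]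
  omega

theorem primeCounting_add_one_lt_e_add {n : ℕ} (hn : 1 < n) (h2 : ¬ (p n + 2).Prime)
    (hq : (3 * p n + 2).Prime) : Nat.primeCounting (3 * p n) + 1 < e n + n := by
  have hsub : ((insert (3 * p n + 2) ((Finset.Ico (p n) (3 * p n)).filter Nat.Prime) :
      Finset ℕ) : Set ℕ) ⊆ atoms n := by
    rw [Finset.coe_insert]
    exact Set.insert_subset (three_mul_add_two_mem_atoms hn h2 hq) (coe_primes_Ico_subset_atoms hn)
  have h := Set.ncard_le_ncard hsub (finite_atoms n)
  rw [Set.ncard_coe_finset, Finset.card_insert_of_notMem (by simp)] at h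
  rw [primeCounting_three_mul_p, e]
  omega

/-- The second alternative, with the extra atom `3q + 2`, is needed for `q = 13, 19, 23`. -/
theorem primeCounting_three_mul_of_small : ∀ q < 29, 3 ≤ q → q.Prime →
    2 * Nat.primeCounting q ≤ Nat.primeCounting (3 * q) ∧
    (9 * Nat.primeCounting q ≤ 4 * (Nat.primeCounting (3 * q) + 1) ∨
      (¬ (q + 2).Prime ∧ (3 * q + 2).Prime ∧
        9 * Nat.primeCounting q ≤ 4 * (Nat.primeCounting (3 * q) + 2))) := by
  decide +kernel

theorem five_mul_le_four_mul_e {n : ℕ} (hn : 0 < n) : 5 * n ≤ 4 * e n := by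
  rcases (show n = 1 ∨ 1 < n by omega) with rfl | h1
  · rw [e_one]; norm_num
  have hlt := primeCounting_lt_e_add h1
  have hp3 := three_le_p h1
  have hpn := primeCounting_p hn
  rcases lt_or_ge (p n) 29 with h | h
  · rcases (primeCounting_three_mul_of_small (p n) h hp3 (prime_p n)).2 with h2 | ⟨h2, h3, h4⟩
    · omega
    · have := primeCounting_add_one_lt_e_add h1 h2 h3
      omega
  · have := nine_mul_primeCounting_le h (not_prime_three_mul (by omega))
    omega

theorem two_mul_le_primeCounting {n : ℕ} (hn : 1 < n) : 2 * n ≤ Nat.primeCounting (3 * p n) := by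
  have hp3 := three_le_p hn
  have hpn := primeCounting_p (show 0 < n by omega)
  rcases lt_or_ge (p n) 29 with h | h
  · have := (primeCounting_three_mul_of_small (p n) h hp3 (prime_p n)).1
    omega
  · have h1 := nine_mul_primeCounting_le h (not_prime_three_mul (by omega))
    -- `9n ≤ 4 (π + 1)` yields `2n ≤ π` only from `n = 4` on; here `n ≥ 10`.
    have h2 := Nat.monotone_primeCounting h
    rw [show Nat.primeCounting 29 = 10 by decide +kernel] at h2
    omega

theorem lt_e {n : ℕ} (hn : 0 < n) : n < e n := by
  rcases (show n = 1 ∨ 1 < n by omega) with rfl | h1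
  · rw [e_one]; norm_num
  · have := primeCounting_lt_e_add h1
    have := two_mul_le_primeCounting h1
    omega

theorem two_mul_p_lt_u {n : ℕ} (hn : 1 < n) : 2 * p n < u n := by
  have hp3 := three_le_p hn
  obtain ⟨q, hq, h1, h2⟩ := exists_prime_between (show 2 ≤ p n by omega)
  have h3 : q ≠ 3 * p n := by
    rintro rfl
    exact not_prime_three_mul (by omega) hq
  have := (isGreatest_u n).2 (mem_atoms_of_prime hn hq (by omega) (by omega))
  omega

/-! ### The case `n = 8` -/

theorem mem_S_eight_of_prime {q : ℕ} (hq : q.Prime) (h : 19 ≤ q) : q ∈ S 8 :=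
  mem_S_of_prime hq (p_eight.le.trans h)

theorem mem_S_eight_of_even (m : ℕ) (he : Even m) (hm : 46 ≤ m) : m ∈ S 8 := by
  -- The range from 46 to 84 has length `38 = 19 + 19`, the step of the induction.
  have hsmall : ∀ m < 84, Even m → 46 ≤ m →
      ∃ q < 84, q.Prime ∧ 19 ≤ q ∧ q ≤ m ∧ (m - q).Prime ∧ 19 ≤ m - q := by decide +kernel
  induction m using Nat.strong_induction_on with
  | _ m ih =>
    rcases lt_or_ge m 84 with h | h
    · obtain ⟨q, -, h1, h2, h3, h4, h5⟩ := hsmall m h he hm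
      have := add_mem (mem_S_eight_of_prime h1 h2) (mem_S_eight_of_prime h4 h5)
      rwa [Nat.add_sub_cancel' h3] at this
    · have h19 : 19 ∈ S 8 := mem_S_eight_of_prime (by norm_num) le_rfl
      have := add_mem (ih (m - 38) (by omega) (he.tsub (by decide)) (by omega)) (add_mem h19 h19)
      rwa [Nat.sub_add_cancel (show 19 + 19 ≤ m by omega)] at this

theorem atoms_eight :
    atoms 8 = (({19, 23, 29, 31, 37, 41, 43, 47, 53, 59} : Finset ℕ) : Set ℕ) := by
  ext a
  rw [Finset.mem_coe]
  constructor
  · intro ha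
    obtain ⟨h1, h2⟩ := prime_of_mem_atoms ha
    rw [p_eight] at h2
    rcases lt_or_ge a 61 with h | h
    · have : ∀ a < 61, a.Prime → 19 ≤ a →
          a ∈ ({19, 23, 29, 31, 37, 41, 43, 47, 53, 59} : Finset ℕ) := by decide +kernel
      exact this a h h1 h2
    · exfalso
      have h19 : 19 ∈ S 8 := mem_S_eight_of_prime (by norm_num) le_rfl
      -- For odd `a ≥ 65` the difference is even and at least 46; the prime 61 is `19 + 19 + 23`.
      refine ha.2.2 ⟨19, h19, a - 19, ?_, by norm_num, by omega, by omega⟩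
      have ho := odd_of_prime_of_three_le h1 (by omega)
      rcases (show a = 61 ∨ a = 62 ∨ a = 63 ∨ a = 64 ∨ 65 ≤ a by omega) with
        rfl | rfl | rfl | rfl | h
      · exact add_mem h19 (mem_S_eight_of_prime (q := 23) (by norm_num) (by norm_num))
      · exact absurd h1 (by norm_num)
      · exact absurd h1 (by norm_num)
      · exact absurd h1 (by norm_num)
      · exact mem_S_eight_of_even _ (Nat.Odd.sub_odd ho (by decide)) (by omega)
  · intro ha
    have h8 : 1 < 8 := by norm_num
    have h59 : 59 ∈ atoms 8 := by
      have := three_mul_add_two_mem_atoms h8 (by rw [p_eight]; norm_num)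
        (by rw [p_eight]; norm_num)
      rwa [p_eight] at this
    have : ∀ a ∈ ({19, 23, 29, 31, 37, 41, 43, 47, 53, 59} : Finset ℕ),
        a.Prime ∧ 19 ≤ a ∧ (a < 57 ∨ a = 59) := by decide +kernel
    obtain ⟨h1, h2, h3⟩ := this a ha
    rcases h3 with h3 | rfl
    · exact mem_atoms_of_prime h8 h1 (by rwa [p_eight]) (by rw [p_eight]; omega)
    · exact h59

theorem e_eight : e 8 = 10 := by
  rw [e, atoms_eight, Set.ncard_coe_finset]
  rfl

/-! ### Sporadic elements -/

theorem card_le_s {n : ℕ} (t : Finset ℕ) (h : ∀ x ∈ t, x ∈ S n ∧ x < f n) :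
    (t.card : ℤ) ≤ s n := by
  rw [s_eq_ncard, ← Set.ncard_coe_finset]
  exact_mod_cast Set.ncard_le_ncard h ((Set.finite_Iio (f n)).subset fun x hx => hx.2)

theorem le_f_of_odd {n x : ℕ} (hn : 1 < n) (h0 : 0 < x) (ho : ¬ Even x) (hp : ¬ x.Prime)
    (h3 : x < 3 * p n) : x ≤ f n := by
  refine (isGreatest_f n).2 ⟨h0, fun hx => ?_⟩
  rcases mem_S_cases hn hx with h | h | h | h
  · omega
  · exact hp h.1
  · exact ho h.1
  · omega

/-- Of the six numbers below `3q`, three are even and `3q - 6` is a proper multiple of 3. -/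
theorem count_prime_three_mul_le {q : ℕ} (ho : Odd q) (hq : 5 ≤ q) :
    Nat.count Nat.Prime (3 * q) ≤ Nat.count Nat.Prime (3 * q - 6) + 2 := by
  obtain ⟨k, rfl⟩ := ho
  rw [show 3 * (2 * k + 1) = (6 * k - 3) + 1 + 1 + 1 + 1 + 1 + 1 by omega, Nat.count_succ,
    Nat.count_succ, Nat.count_succ, Nat.count_succ, Nat.count_succ, Nat.count_succ]
  have h0 : ¬ (6 * k - 3).Prime := by
    rw [show 6 * k - 3 = 3 * (2 * k - 1) by omega]
    exact not_prime_three_mul (by omega)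
  have h1 : ¬ (6 * k - 3 + 1).Prime := by
    rw [show 6 * k - 3 + 1 = 2 * (3 * k - 1) by omega]
    exact Nat.not_prime_mul (by norm_num) (by omega)
  have h3 : ¬ (6 * k - 3 + 1 + 1 + 1).Prime := by
    rw [show 6 * k - 3 + 1 + 1 + 1 = 3 * (2 * k) by omega]
    exact not_prime_three_mul (by omega)
  have h5 : ¬ (6 * k - 3 + 1 + 1 + 1 + 1 + 1).Prime := by
    rw [show 6 * k - 3 + 1 + 1 + 1 + 1 + 1 = 2 * (3 * k + 1) by omega]
    exact Nat.not_prime_mul (by norm_num) (by omega)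
  rw [if_neg h0, if_neg h1, if_neg h3, if_neg h5,
    show 6 * k - 3 + 1 + 1 + 1 + 1 + 1 + 1 - 6 = 6 * k - 3 by omega]
  split_ifs <;> omega

/-- For `n > 2`, at most two of the primes in `[p, 3p)` are lost by stopping at the gap `3p - 6`, so
with `0` there remain at least `1 + (π(3p) - (n - 1)) - 2 = π(3p) - n ≥ n` sporadic elements. For `n
= 2` the number `3p - 6 = 3` is no gap, and 4 replaces it. -/
theorem le_s {n : ℕ} (hn : 0 < n) : (n : ℤ) ≤ s n := by
  rcases (show n = 1 ∨ n = 2 ∨ 2 < n by omega) with rfl | rfl | h2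
  · rw [s, f_one, g_one]; norm_num
  · have h4 : 4 ≤ f 2 := by
      refine (isGreatest_f 2).2 ⟨by norm_num, fun hx => ?_⟩
      rcases mem_S_cases (by norm_num) hx with h | h | h | h
      · omega
      · exact absurd h.1 (by norm_num)
      · rw [p_two] at h; omega
      · rw [p_two] at h; omega
    refine card_le_s {0, 3} fun x hx => ?_
    simp only [Finset.mem_insert, Finset.mem_singleton] at hx
    rcases hx with rfl | rfl
    · exact ⟨zero_mem _, by omega⟩
    · exact ⟨mem_S_of_prime Nat.prime_three p_two.le, by omega⟩
  · have h1 : 1 < n := by omega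
    have hp5 := five_le_p h2
    have ho := odd_of_prime_of_three_le (prime_p n) (by omega)
    have hf : 3 * p n - 6 ≤ f n := by
      refine le_f_of_odd h1 (by omega) ?_ ?_ (by omega)
      · rw [Nat.even_iff]
        rw [Nat.odd_iff] at ho
        omega
      · rw [show 3 * p n - 6 = 3 * (p n - 2) by omega]
        exact not_prime_three_mul (by omega)
    have h3 := card_le_s (n := n) (insert 0 ((Finset.Ico (p n) (3 * p n - 6)).filter Nat.Prime))
      fun x hx => by
        rw [Finset.mem_insert, Finset.mem_filter, Finset.mem_Ico] at hx
        rcases hx with rfl | hx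
        · exact ⟨zero_mem _, by omega⟩
        · exact ⟨mem_S_of_prime hx.2 hx.1.1, by omega⟩
    rw [Finset.card_insert_of_notMem (by simp [Nat.not_prime_zero])] at h3
    have h4 := card_primes_Ico (show p n ≤ 3 * p n - 6 by omega)
    have h5 := count_prime_three_mul_le ho hp5
    have h6 := two_mul_le_primeCounting h1
    rw [primeCounting_of_not_prime (not_prime_three_mul (by omega))] at h6
    rw [count_prime_p] at h4
    omega

/-! ### The ratios and their minima -/

theorem isLeast_one_half {h : ℕ → ℕ} (h1 : h 1 = 1) (hle : ∀ n, p n - 1 ≤ h n) :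
    IsLeast ((fun n : ℕ => (h n : ℚ) / (p n : ℚ)) '' Set.Ioi 0) (1 / 2) := by
  refine ⟨⟨1, by simp, by simp [h1, p_one]⟩, ?_⟩
  rintro _ ⟨n, -, rfl⟩
  have h2 := (prime_p n).two_le
  have hpos : (0 : ℚ) < p n := by exact_mod_cast (prime_p n).pos
  have h3 : p n ≤ 2 * h n := by
    have := hle n
    omega
  have h4 : (p n : ℚ) ≤ 2 * h n := by exact_mod_cast h3
  simp only
  rw [div_le_div_iff₀ (by norm_num) hpos]
  linarith

theorem two_lt_u_div_p {n : ℕ} (hn : 1 < n) : 2 < (u n : ℚ) / (p n : ℚ) := by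
  have hpos : (0 : ℚ) < p n := by exact_mod_cast (prime_p n).pos
  rw [lt_div_iff₀ hpos]
  exact_mod_cast two_mul_p_lt_u hn

theorem u_one_div_p_one : (u 1 : ℚ) / (p 1 : ℚ) = 3 / 2 := by
  rw [u_one, p_one]
  norm_num

end PrimeSemigroup

theorem proposition2 :
    -- `min (f/p) = min (g/p) = 1/2`
    IsLeast ((fun n : ℕ => (PrimeSemigroup.f n : ℚ) / (PrimeSemigroup.p n : ℚ)) '' Set.Ioi 0)
      (1 / 2) ∧
    IsLeast ((fun n : ℕ => (PrimeSemigroup.g n : ℚ) / (PrimeSemigroup.p n : ℚ)) '' Set.Ioi 0)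
      (1 / 2) ∧
    -- `min (u/p) = 3/2`, attained at `n = 1` only, and `u/p > 2` for `n > 1`
    IsLeast ((fun n : ℕ => (PrimeSemigroup.u n : ℚ) / (PrimeSemigroup.p n : ℚ)) '' Set.Ioi 0)
      (3 / 2) ∧
    (∀ n : ℕ, 0 < n →
      ((PrimeSemigroup.u n : ℚ) / (PrimeSemigroup.p n : ℚ) = 3 / 2 ↔ n = 1)) ∧
    (∀ n : ℕ, 1 < n → 2 < (PrimeSemigroup.u n : ℚ) / (PrimeSemigroup.p n : ℚ)) ∧
    -- `min (e/n) = 5/4`, attained at `n = 8`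
    IsLeast ((fun n : ℕ => (PrimeSemigroup.e n : ℚ) / (n : ℚ)) '' Set.Ioi 0) (5 / 4) ∧
    (PrimeSemigroup.e 8 : ℚ) / ((8 : ℕ) : ℚ) = 5 / 4 ∧
    -- `e(n) > n` and `s(n) > n - 1` for all `n > 0`
    (∀ n : ℕ, 0 < n → n < PrimeSemigroup.e n) ∧
    (∀ n : ℕ, 0 < n → (n : ℤ) - 1 < PrimeSemigroup.s n) := by
  refine ⟨PrimeSemigroup.isLeast_one_half PrimeSemigroup.f_one PrimeSemigroup.p_sub_one_le_f,
    PrimeSemigroup.isLeast_one_half PrimeSemigroup.g_one PrimeSemigroup.p_sub_one_le_g,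
    ⟨⟨1, by simp, PrimeSemigroup.u_one_div_p_one⟩, ?_⟩, fun n hn => ⟨fun h => ?_, ?_⟩,
    fun n hn => PrimeSemigroup.two_lt_u_div_p hn, ⟨⟨8, by simp, ?_⟩, ?_⟩, ?_,
    fun n hn => PrimeSemigroup.lt_e hn, fun n hn => ?_⟩
  · rintro _ ⟨n, hn, rfl⟩
    rcases (show n = 1 ∨ 1 < n by have : 0 < n := hn; omega) with rfl | h1
    · exact PrimeSemigroup.u_one_div_p_one.ge
    · exact le_trans (by norm_num) (PrimeSemigroup.two_lt_u_div_p h1).le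
  · by_contra h1
    have := PrimeSemigroup.two_lt_u_div_p (show 1 < n by omega)
    rw [h] at this
    norm_num at this
  · rintro rfl
    exact PrimeSemigroup.u_one_div_p_one
  · simp only [PrimeSemigroup.e_eight]
    norm_num
  · rintro _ ⟨n, hn, rfl⟩
    have hn' : (0 : ℚ) < n := by exact_mod_cast hn
    have h : (5 * n : ℚ) ≤ 4 * PrimeSemigroup.e n := by
      exact_mod_cast PrimeSemigroup.five_mul_le_four_mul_e hn
    simp only
    rw [div_le_div_iff₀ (by norm_num) hn']
    linarith
  · rw [PrimeSemigroup.e_eight]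
    norm_num
  · have := PrimeSemigroup.le_s hn
    omega
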